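/- Let $\mathcal A=\{1,2,3\}$. For $x\in\mathcal A^{\mathbb Z}$ let $F_x(n)$ be the set of subwords of $x$ of length $n$ and $F_x=\bigcup_{n\ge 0}F_x(n)$. A word $u$ is right-special (left-special) for $x$ if there are symbols $a\ne b$ with $ua,ub\in F_x$ (resp. $au,bu\in F_x$), and bispecial if it is both. The sequence $x$ is an Arnoux–Rauzy sequence over $\mathcal A$ if every word in $F_x$ occurs in $x$ with bounded gaps, $|F_x(n)|=2n+1$ for every $n$, and each $F_x(n)$ contains exactly one right-special and exactly one left-special word. If $w_1,w_2,w_3,\dots$ are the bispecial words of $x$ in the order of increasing length ($w_1$ being the empty word), the index sequence $(i_n)$ of $x$ is defined by letting $i_n$ be the unique symbol such that $i_nw_n$ is right-special. The (two-sided) Tribonacci subshift is $X_{\rm Trib}=\{y\in\mathcal A^{\mathbb Z}: F_y(n)=F_x(n)\text{ for all }n\}$, where $x\in\mathcal A^{\mathbb Z}$ is an Arnoux–Rauzy sequence with index sequence $1,2,3,1,2,3,\dots$. Let $f:\mathcal A\to\mathbb R$ be non-constant and, for $x\in X_{\rm Trib}$, let $H_x$ be the Schrödinger operator on $\ell^2(\mathbb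 Z)$ given by $$(H_x\phi)(n)=\phi(n+1)+\phi(n-1)+f(x_n)\,\phi(n).$$ For $\phi\in\ell^2(\mathbb Z)$ let $\mu_\phi$ be the spectral measure of $H_x$ and $\phi$, i.e. the finite Borel measure on $\mathbb R$ with $\langle\phi,(H_x-z)^{-1}\phi\rangle=\int_{\mathbb R}\frac{d\mu_\phi(t)}{t-z}$ for all $z$ with $\operatorname{Im}z>0$. Let $\mathcal H_{\rm pp}$ be the set of those $\phi$ for which $\mu_\phi$ is a pure point measure (carried by a countable set), and let $\sigma_{\rm pp}(H_x)$ be the spectrum of the restriction of $H_x$ to $\mathcal H_{\rm pp}$. Let $\nu$ be the (unique) shift-invariant Borel probability measure on $X_{\rm Trib}$. Then $\sigma_{\rm pp}(H_x)=\emptyset$ for $\nu$-almost every $x\in X_{\rm Trib}$. -/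

import Mathlib

open scoped lp InnerProductSpace

namespace ArnouxRauzy

section Words

variable {A : Type*}

/-- The word `x_j x_{j+1} … x_{j+n-1}` read off a two-sided sequence `x`. -/
def word (x : ℤ → A) (j : ℤ) (n : ℕ) : List A :=
  List.ofFn fun i : Fin n => x (j + (i : ℕ))

/-- `F_x(n)`: the set of factors (subwords) of `x` of length `n`. -/
def factorsOfLength (x : ℤ → A) (n : ℕ) : Set (List A) :=
  Set.range fun j : ℤ => word x j n

/-- `F_x`: the set of all factors of `x`. -/
def factors (x : ℤ → A) : Set (List A) :=
  ⋃ n : ℕ, factorsOfLength x n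

/-- Each factor of `x` occurs in `x` with bounded gaps. -/
def IsUniformlyRecurrent (x : ℤ → A) : Prop :=
  ∀ u ∈ factors x, ∃ L : ℕ, ∀ j : ℤ, ∃ m : ℤ, j ≤ m ∧ m < j + L ∧ word x m u.length = u

/-- The factor `u` has at least two extensions to the right. -/
def IsRightSpecial (x : ℤ → A) (u : List A) : Prop :=
  ∃ a b : A, a ≠ b ∧ u ++ [a] ∈ factors x ∧ u ++ [b] ∈ factors x

/-- The factor `u` has at least two extensions to the left. -/
def IsLeftSpecial (x : ℤ → A) (u : List A) : Prop :=
  ∃ a b : A, a ≠ b ∧ a :: u ∈ factors x ∧ b :: u ∈ factors x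

def IsBispecial (x : ℤ → A) (u : List A) : Prop :=
  IsRightSpecial x u ∧ IsLeftSpecial x u

/-- Two-sided Arnoux-Rauzy sequences over the alphabet `Fin k` of `k ≥ 2` symbols. -/
structure IsArnouxRauzy {k : ℕ} (x : ℤ → Fin k) : Prop where
  two_le : 2 ≤ k
  uniformlyRecurrent : IsUniformlyRecurrent x
  complexity : ∀ n : ℕ, (factorsOfLength x n).ncard = (k - 1) * n + 1
  rightSpecial : ∀ n : ℕ, ∃! r, r ∈ factorsOfLength x n ∧ IsRightSpecial x r
  leftSpecial : ∀ n : ℕ, ∃! l, l ∈ factorsOfLength x n ∧ IsLeftSpecial x l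

/-- `I` is the index sequence of `x`: with the bispecial factors of `x` listed as
`w 0, w 1, w 2, …` in the order of increasing length, `I n` is the symbol for which the word
`(I n) (w n)` is right-special. (Enumeration starts at `0`.) -/
def IsIndexSequence {k : ℕ} (x : ℤ → Fin k) (I : ℕ → Fin k) : Prop :=
  ∃ w : ℕ → List (Fin k),
    StrictMono (fun n => (w n).length) ∧ Set.range w = {u | IsBispecial x u} ∧
      ∀ n, IsRightSpecial x (I n :: w n)

/-- The two-sided subshift associated with `x`. -/
def subshift (x : ℤ → A) : Set (ℤ → A) :=
  {y | ∀ n : ℕ, factorsOfLength y n = factorsOfLength x n}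

/-- The sequence `1, 2, 3, 1, 2, 3, …`; the symbols `1, 2, 3` are the elements `0, 1, 2` of
`Fin 3`. -/
def tribonacciIndex (n : ℕ) : Fin 3 :=
  ⟨n % 3, Nat.mod_lt n (by norm_num)⟩

/-- `X` is the Tribonacci subshift: the two-sided Arnoux-Rauzy subshift over three symbols with
index sequence `1, 2, 3, 1, 2, 3, …`. -/
def IsTribonacciSubshift (X : Set (ℤ → Fin 3)) : Prop :=
  ∃ x : ℤ → Fin 3, IsArnouxRauzy x ∧ IsIndexSequence x tribonacciIndex ∧ X = subshift x

/-- The left shift on two-sided sequences. -/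
def shift (x : ℤ → A) : ℤ → A := fun n => x (n + 1)

end Words

section Operators

/-- Translation by `m` on `ℓ²(ℤ)`: `φ ↦ (n ↦ φ (n + m))`. -/
noncomputable def translation (m : ℤ) : ℓ²(ℤ, ℂ) →L[ℂ] ℓ²(ℤ, ℂ) :=
  LinearMap.mkContinuous
    { toFun := fun φ => ⟨fun n => φ (n + m), by
        have h := (memℓp_gen_iff (by norm_num)).1 (lp.memℓp φ)
        exact memℓp_gen ((Equiv.addRight m).summable_iff.2 h)⟩
      map_add' := fun _ _ => rfl
      map_smul' := fun _ _ => rfl }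
    1
    fun φ => by
      rw [one_mul]
      refine lp.norm_le_of_tsum_le (by norm_num) (norm_nonneg φ) ?_
      rw [lp.norm_rpow_eq_tsum (by norm_num) φ]
      exact ((Equiv.addRight m).tsum_eq fun n => ‖φ n‖ ^ (2 : ENNReal).toReal).le

/-- Multiplication by a bounded potential `V` on `ℓ²(ℤ)`. -/
noncomputable def potential (V : ℤ → ℝ) (hV : ∃ C : ℝ, 0 ≤ C ∧ ∀ n, |V n| ≤ C) :
    ℓ²(ℤ, ℂ) →L[ℂ] ℓ²(ℤ, ℂ) :=
  lp.mapCLM 2 (fun n => (V n : ℂ) • ContinuousLinearMap.id ℂ ℂ) hV.choose_spec.1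
    fun n => by simpa [norm_smul] using hV.choose_spec.2 n

/-- The Schrödinger operator `(H φ)(n) = φ(n+1) + φ(n-1) + V(n) φ(n)` on `ℓ²(ℤ)` with bounded
potential `V`. -/
noncomputable def schrodinger (V : ℤ → ℝ) (hV : ∃ C : ℝ, 0 ≤ C ∧ ∀ n, |V n| ≤ C) :
    ℓ²(ℤ, ℂ) →L[ℂ] ℓ²(ℤ, ℂ) :=
  translation 1 + translation (-1) + potential V hV

theorem schrodinger_apply (V : ℤ → ℝ) (hV : ∃ C : ℝ, 0 ≤ C ∧ ∀ n, |V n| ≤ C)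
    (φ : ℓ²(ℤ, ℂ)) (n : ℤ) :
    schrodinger V hV φ n = φ (n + 1) + φ (n - 1) + V n * φ n := rfl

theorem exists_bound_comp {k : ℕ} (f : Fin k → ℝ) (x : ℤ → Fin k) :
    ∃ C : ℝ, 0 ≤ C ∧ ∀ n, |f (x n)| ≤ C :=
  ⟨∑ a, |f a|, Finset.sum_nonneg fun _ _ => abs_nonneg _, fun n =>
    Finset.single_le_sum (f := fun a => |f a|) (fun _ _ => abs_nonneg _)
      (Finset.mem_univ (x n))⟩

/-- `H_x`: the Schrödinger operator with potential `V_x(n) = f(x_n)`. -/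
noncomputable def operatorAt {k : ℕ} (f : Fin k → ℝ) (x : ℤ → Fin k) :
    ℓ²(ℤ, ℂ) →L[ℂ] ℓ²(ℤ, ℂ) :=
  schrodinger (fun n => f (x n)) (exists_bound_comp f x)

variable {E : Type*} [NormedAddCommGroup E] [InnerProductSpace ℂ E]

/-- `μ` is the spectral measure of `H` and `φ`: the finite measure on `ℝ` such that
`⟨φ, (H - z)⁻¹ φ⟩ = ∫ dμ(t) / (t - z)` whenever `Im z > 0`. -/
def IsSpectralMeasure (H : E →L[ℂ] E) (φ : E) (μ : MeasureTheory.Measure ℝ) : Prop :=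
  MeasureTheory.IsFiniteMeasure μ ∧
    ∀ z : ℂ, 0 < z.im →
      ⟪φ, Ring.inverse (H - z • ContinuousLinearMap.id ℂ E) φ⟫_ℂ = ∫ t : ℝ, ((t : ℂ) - z)⁻¹ ∂μ

/-- A pure point measure: one that is carried by a countable set. -/
def IsPurePoint (μ : MeasureTheory.Measure ℝ) : Prop :=
  ∃ S : Set ℝ, S.Countable ∧ μ Sᶜ = 0

/-- `ℋ_pp`: the vectors whose spectral measure is pure point. -/
def purePointSubspace (H : E →L[ℂ] E) : Set E :=
  {φ | ∃ μ : MeasureTheory.Measure ℝ, IsSpectralMeasure H φ μ ∧ IsPurePoint μ}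

/-- The spectrum of the restriction of `H` to `M`: the `z` for which `H - z` is not a bijection of
`M` onto itself. (For `M` a closed invariant subspace of a Hilbert space, bijectivity is
the same as bounded invertibility of the restriction.) -/
def spectrumOn (H : E →L[ℂ] E) (M : Set E) : Set ℂ :=
  {z | ¬ Set.BijOn (fun φ => H φ - z • φ) M M}

/-- `σ_pp(H)`: the spectrum of the restriction of `H` to `ℋ_pp`. -/
def purePointSpectrum (H : E →L[ℂ] E) : Set ℂ :=
  spectrumOn H (purePointSubspace H)

end Operators

end ArnouxRauzy

/-!
A sequence in which blocks of unbounded length are repeated three times around a fixed place gives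
a Schrödinger operator without eigenvectors: this is Gordon's criterion
(`eq_zero_of_frequently_cube`), which follows from the identity of Cayley and Hamilton for the
transfer matrix over one block. A vector of `ℋ_pp` other than zero has a spectral measure with an
atom, and an atom forces an eigenvector, because `ε (H - t - i ε)⁻¹` tends to zero strongly when
`H - t` is injective (`purePointSubspace_subset`). So `ℋ_pp` is trivial for such sequences, and it
remains to find the repetitions in almost every sequence of the subshift.

The language of an Arnoux-Rauzy sequence is coded through the substitution `s ↦ s`, `a ↦ s a`, where
`s` is the first symbol of its index sequence, by a language of the same kind whose index sequence
is shifted (`IsARLanguage.derived`). Working with languages instead of sequences avoids the choice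
of cutting points. At level `m`, the bispecial word `w m` follows the image of every word; the
square `s s` of the separating symbol `s` of that level therefore yields a word of length
`2 p + |w m|` with period `p`, where `p` is the length of the image of `s`
(`iterSubst_pair_periodic`). For the index sequence `1, 2, 3, 1, 2, 3, …` the periods obey the
Tribonacci recursion and `|w m|` is the sum of the periods before `p`, which from the fourth level
on exceeds `p` by a definite proportion (`add_le_tribLength`). Hence each occurrence of that word
contains a positive proportion of `p` centres of three-block repetitions with period `p`. The word
occurs in the image of every symbol four levels further on, so the gaps between its occurrences are
bounded by a multiple of `p`. The centres thus have a frequency that is bounded below uniformly in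
the level (`exists_many_cubes`).

Finally, sets that are visited with frequencies bounded below are visited infinitely often from
some point of almost every orbit (`ae_exists_frequently_mem`). The frequency bound holds for every
sequence of the subshift, so that it applies to the invariant set of exceptional points as well, and
neither ergodicity nor unique ergodicity is needed.
-/

namespace ArnouxRauzy

/-! ### Arnoux-Rauzy languages -/

section Language

variable {A : Type*}

/-- `u` has two extensions to the right in the language `L`. -/
def RightSpecialIn (L : Set (List A)) (u : List A) : Prop :=
  ∃ a b : A, a ≠ b ∧ u ++ [a] ∈ L ∧ u ++ [b] ∈ L

/-- `u` has two extensions to the left in the language `L`. -/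
def LeftSpecialIn (L : Set (List A)) (u : List A) : Prop :=
  ∃ a b : A, a ≠ b ∧ a :: u ∈ L ∧ b :: u ∈ L

/-- The language of an Arnoux-Rauzy sequence with index sequence `I`: it is closed under factors
and irreducible, of each length it has at most one right-special and at most one left-special
word, these have all possible extensions, and the bispecial words are indexed by `I`. -/
structure IsARLanguage (L : Set (List A)) (I : ℕ → A) : Prop where
  mem_of_infix : ∀ {u v}, u <:+: v → v ∈ L → u ∈ L
  irreducible : ∀ {u v}, u ∈ L → v ∈ L → ∃ y, u ++ y ++ v ∈ L
  right_unique : ∀ {u v}, RightSpecialIn L u → RightSpecialIn L v → u.length = v.length → u = v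
  right_full : ∀ {u}, RightSpecialIn L u → ∀ a, u ++ [a] ∈ L
  left_unique : ∀ {u v}, LeftSpecialIn L u → LeftSpecialIn L v → u.length = v.length → u = v
  left_full : ∀ {u}, LeftSpecialIn L u → ∀ a, a :: u ∈ L
  index : ∃ w : ℕ → List A, StrictMono (fun n => (w n).length) ∧
    Set.range w = {u | RightSpecialIn L u ∧ LeftSpecialIn L u} ∧
    ∀ n, RightSpecialIn L (I n :: w n)

namespace IsARLanguage

variable {L : Set (List A)} {I : ℕ → A} (hL : IsARLanguage L I)
include hL

theorem rightSpecial_of_suffix {u v : List A} (h : u <:+ v) (hv : RightSpecialIn L v) :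
    RightSpecialIn L u := by
  obtain ⟨t, rfl⟩ := h
  obtain ⟨a, b, hab, ha, hb⟩ := hv
  exact ⟨a, b, hab, hL.mem_of_infix ⟨t, [], by simp⟩ ha, hL.mem_of_infix ⟨t, [], by simp⟩ hb⟩

theorem leftSpecial_of_prefix {u v : List A} (h : u <+: v) (hv : LeftSpecialIn L v) :
    LeftSpecialIn L u := by
  obtain ⟨t, rfl⟩ := h
  obtain ⟨a, b, hab, ha, hb⟩ := hv
  exact ⟨a, b, hab, hL.mem_of_infix ⟨[], t, by simp⟩ ha, hL.mem_of_infix ⟨[], t, by simp⟩ hb⟩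

theorem rightSpecial_singleton : RightSpecialIn L [I 0] := by
  obtain ⟨w, hmono, hrange, hw⟩ := hL.index
  have hnil : RightSpecialIn L [] ∧ LeftSpecialIn L [] := by
    have h : w 0 ∈ {u | RightSpecialIn L u ∧ LeftSpecialIn L u} := hrange ▸ ⟨0, rfl⟩
    exact ⟨hL.rightSpecial_of_suffix List.nil_suffix h.1,
      hL.leftSpecial_of_prefix List.nil_prefix h.2⟩
  obtain ⟨m, hm⟩ : [] ∈ Set.range w := by rw [hrange]; exact hnil
  have hm0 : m = 0 := by
    by_contra h
    have := hmono (Nat.pos_of_ne_zero h)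
    simp [hm] at this
  subst hm0
  simpa [hm] using hw 0

theorem singleton_mem : [I 0] ∈ L := by
  obtain ⟨a, b, -, h, -⟩ := hL.rightSpecial_singleton
  exact hL.mem_of_infix ⟨[], [a], by simp⟩ h

theorem exists_append_mem {u : List A} (hu : u ∈ L) : ∃ a, u ++ [a] ∈ L := by
  obtain ⟨y, hy⟩ := hL.irreducible hu hL.singleton_mem
  cases y with
  | nil => exact ⟨_, by simpa using hy⟩
  | cons a y => exact ⟨a, hL.mem_of_infix ⟨[], y ++ [I 0], by simp⟩ hy⟩

theorem exists_cons_mem {u : List A} (hu : u ∈ L) : ∃ a, a :: u ∈ L := by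
  obtain ⟨y, hy⟩ := hL.irreducible hL.singleton_mem hu
  rcases List.eq_nil_or_concat y with rfl | ⟨y, a, rfl⟩
  · exact ⟨_, by simpa using hy⟩
  · exact ⟨a, hL.mem_of_infix ⟨I 0 :: y, [], by simp⟩ hy⟩

theorem succ_unique {a b c : A} (ha : a ≠ I 0) (hb : [a, b] ∈ L) (hc : [a, c] ∈ L) : b = c := by
  by_contra h
  have := hL.right_unique (u := [a]) ⟨b, c, h, hb, hc⟩ hL.rightSpecial_singleton rfl
  exact ha (by simpa using this)

/-- Every symbol other than the separating one is followed by the separating one. If `c` followed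
both the separating symbol and another one, it would be left-special and thus follow every symbol,
itself included; being its only successor, it could never be left. -/
theorem eq_of_pair_mem {a c : A} (ha : a ≠ I 0) (h : [a, c] ∈ L) : c = I 0 := by
  by_contra hc
  have hsc : [I 0, c] ∈ L := hL.right_full hL.rightSpecial_singleton c
  have hcc : [c, c] ∈ L := hL.left_full (u := [c]) ⟨a, I 0, ha, h, hsc⟩ c
  have hc' : [c] ∈ L := hL.mem_of_infix ⟨[c], [], by simp⟩ hcc
  obtain ⟨y, hy⟩ := hL.irreducible hc' hL.singleton_mem
  have key : ∀ z : List A, [c] ++ z ++ [I 0] ∈ L → False := by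
    intro z
    induction z with
    | nil => exact fun hz => hc (hL.succ_unique hc hcc hz)
    | cons d z ih =>
      intro hz
      have hd : [c, d] ∈ L := hL.mem_of_infix ⟨[], z ++ [I 0], by simp⟩ hz
      have := hL.succ_unique hc hcc hd
      subst this
      exact ih (hL.mem_of_infix ⟨[c], [], by simp⟩ hz)
  exact key y hy

theorem eq_of_pair_mem_left {a c : A} (ha : a ≠ I 0) (h : [c, a] ∈ L) : c = I 0 := by
  by_contra hc
  exact ha (hL.eq_of_pair_mem hc h)

theorem exists_eq_append_of_rightSpecial {u : List A} (hu : RightSpecialIn L u) (h : u ≠ []) :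
    ∃ t, u = t ++ [I 0] := by
  rcases List.eq_nil_or_concat u with rfl | ⟨t, a, rfl⟩
  · exact absurd rfl h
  · have h1 : RightSpecialIn L [a] := hL.rightSpecial_of_suffix ⟨t, by simp⟩ hu
    have := hL.right_unique h1 hL.rightSpecial_singleton rfl
    exact ⟨t, by simp at this; simp [this]⟩

theorem exists_eq_cons_of_leftSpecial {u : List A} (hu : LeftSpecialIn L u) (h : u ≠ []) :
    ∃ t, u = I 0 :: t := by
  cases u with
  | nil => exact absurd rfl h
  | cons a t =>
    obtain ⟨b, c, hbc, hb, hc⟩ : LeftSpecialIn L [a] :=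
      hL.leftSpecial_of_prefix ⟨t, by simp⟩ hu
    by_contra hne
    have ha : a ≠ I 0 := fun h => hne ⟨t, by rw [h]⟩
    exact hbc ((hL.eq_of_pair_mem_left ha hb).trans (hL.eq_of_pair_mem_left ha hc).symm)

theorem prefix_of_leftSpecial {u v : List A} (hu : LeftSpecialIn L u) (hv : LeftSpecialIn L v)
    (h : u.length ≤ v.length) : u <+: v := by
  have h1 : LeftSpecialIn L (v.take u.length) :=
    hL.leftSpecial_of_prefix (List.take_prefix _ _) hv
  have h2 := hL.left_unique hu h1 (by simp [h])
  rw [h2]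
  exact List.take_prefix _ _

theorem suffix_of_rightSpecial {u v : List A} (hu : RightSpecialIn L u) (hv : RightSpecialIn L v)
    (h : u.length ≤ v.length) : u <:+ v := by
  have h1 : RightSpecialIn L (v.drop (v.length - u.length)) :=
    hL.rightSpecial_of_suffix (List.drop_suffix _ _) hv
  have h2 := hL.right_unique hu h1 (by simp; omega)
  rw [h2]
  exact List.drop_suffix _ _

theorem length_le_one_of_notMem {v : List A} (hv : v ∈ L) (hs : I 0 ∉ v) : v.length ≤ 1 := by
  cases v with
  | nil => simp
  | cons a v =>
    cases v with
    | nil => simp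
    | cons b v =>
      have : b = I 0 := hL.eq_of_pair_mem (a := a) (fun h => hs (by simp [h]))
        (hL.mem_of_infix ⟨[], v, by simp⟩ hv)
      exact absurd (by simp [this]) hs

end IsARLanguage

end Language

/-! ### The substitutions and the desubstitution of words -/

section Substitution

variable {A : Type*} [DecidableEq A]

/-- The Arnoux-Rauzy substitution `s ↦ s`, `a ↦ s a` for `a ≠ s`. -/
def subst (s : A) (u : List A) : List A :=
  u.flatMap fun a => if a = s then [s] else [s, a]

/-- The word `τ(u) s`, where `τ` is the substitution with separating symbol `s`. It records that
the image of `u` is always followed by `s`, so that `u` occurs upstairs whenever this word occurs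
downstairs. -/
def substExt (s : A) (u : List A) : List A := subst s u ++ [s]

@[simp] theorem subst_nil (s : A) : subst s [] = [] := rfl

theorem subst_cons (s a : A) (u : List A) :
    subst s (a :: u) = (if a = s then [s] else [s, a]) ++ subst s u := rfl

theorem subst_append (s : A) (u v : List A) : subst s (u ++ v) = subst s u ++ subst s v := by
  simp [subst]

theorem substExt_append (s : A) (u v : List A) :
    substExt s (u ++ v) = subst s u ++ substExt s v := by
  simp [substExt, subst_append]

theorem substExt_cons_self (s : A) (u : List A) : substExt s (s :: u) = s :: substExt s u := by
  simp [substExt, subst_cons]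

theorem substExt_cons_of_ne {s a : A} (h : a ≠ s) (u : List A) :
    substExt s (a :: u) = s :: a :: substExt s u := by
  simp [substExt, subst_cons, h]

theorem substExt_ne_nil (s : A) (u : List A) : substExt s u ≠ [] := by simp [substExt]

theorem exists_substExt_eq_cons (s : A) (u : List A) : ∃ t, substExt s u = s :: t := by
  cases u with
  | nil => exact ⟨[], rfl⟩
  | cons a u =>
    by_cases h : a = s
    · subst h; exact ⟨_, substExt_cons_self a u⟩
    · exact ⟨_, substExt_cons_of_ne h u⟩

theorem substExt_prefix_append (s : A) (u v : List A) : substExt s u <+: substExt s (u ++ v) := by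
  obtain ⟨t, ht⟩ := exists_substExt_eq_cons s v
  exact ⟨t, by rw [substExt_append, ht, substExt]; simp⟩

theorem substExt_suffix_append (s : A) (u v : List A) : substExt s v <:+ substExt s (u ++ v) :=
  ⟨_, (substExt_append s u v).symm⟩

theorem substExt_infix {s : A} {u v : List A} (h : u <:+: v) : substExt s u <:+: substExt s v := by
  obtain ⟨a, b, rfl⟩ := h
  exact (substExt_prefix_append s u b).isInfix.trans
    (by rw [List.append_assoc]; exact (substExt_suffix_append s a (u ++ b)).isInfix)

/-- Decoding is unambiguous: as the image of every word is followed by `s`, a letter `s` and a pair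
`s a` are told apart by the second symbol. -/
theorem prefix_of_substExt_prefix {s : A} {u v : List A} (h : substExt s u <+: substExt s v) :
    u <+: v := by
  induction u generalizing v with
  | nil => exact List.nil_prefix
  | cons a u ih =>
    obtain ⟨t, ht⟩ := exists_substExt_eq_cons s u
    cases v with
    | nil =>
      have h' := h.length_le
      by_cases ha : a = s
      · subst ha; rw [substExt_cons_self, ht] at h'; simp [substExt] at h'
      · rw [substExt_cons_of_ne ha] at h'; simp [substExt] at h'
    | cons b v =>
      obtain ⟨t', ht'⟩ := exists_substExt_eq_cons s v
      by_cases ha : a = s <;> by_cases hb : b = s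
      · subst ha; subst hb
        rw [substExt_cons_self, substExt_cons_self, List.cons_prefix_cons] at h
        exact List.cons_prefix_cons.2 ⟨rfl, ih h.2⟩
      · subst ha
        rw [substExt_cons_self, substExt_cons_of_ne hb, ht, List.cons_prefix_cons,
          List.cons_prefix_cons] at h
        exact absurd h.2.1.symm hb
      · subst hb
        rw [substExt_cons_self, substExt_cons_of_ne ha, ht', List.cons_prefix_cons,
          List.cons_prefix_cons] at h
        exact absurd h.2.1 ha
      · rw [substExt_cons_of_ne ha, substExt_cons_of_ne hb, List.cons_prefix_cons,
          List.cons_prefix_cons] at h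
        exact List.cons_prefix_cons.2 ⟨h.2.1, ih h.2.2⟩

theorem reverse_substExt (s : A) (u : List A) :
    (substExt s u).reverse = substExt s u.reverse := by
  induction u with
  | nil => rfl
  | cons a u ih =>
    rw [List.reverse_cons, substExt_append]
    by_cases h : a = s
    · subst h
      rw [substExt_cons_self, List.reverse_cons, ih]
      simp [substExt, subst_cons]
    · rw [substExt_cons_of_ne h, List.reverse_cons, List.reverse_cons, ih]
      simp [substExt, subst_cons, h]

theorem suffix_of_substExt_suffix {s : A} {u v : List A} (h : substExt s u <:+ substExt s v) :
    u <:+ v := by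
  rw [← List.reverse_prefix] at h ⊢
  rw [reverse_substExt, reverse_substExt] at h
  exact prefix_of_substExt_prefix h

theorem substExt_injective (s : A) : Function.Injective (substExt s) := fun u v h =>
  (prefix_of_substExt_prefix (s := s) (by rw [h])).sublist.antisymm
    (prefix_of_substExt_prefix (s := s) (by rw [h])).sublist

/-- The language that is coded by `L` through the substitution with separating symbol `s`. -/
def derivedLanguage (s : A) (L : Set (List A)) : Set (List A) := {u | substExt s u ∈ L}

namespace IsARLanguage

variable {L : Set (List A)} {I : ℕ → A} (hL : IsARLanguage L I)
include hL

theorem exists_subst_of_cons {u : List A} (hu : I 0 :: u ∈ L) :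
    ∃ v, I 0 :: u = subst (I 0) v := by
  induction h : u.length using Nat.strong_induction_on generalizing u with
  | _ n ih =>
    cases u with
    | nil => exact ⟨[I 0], by simp [subst_cons]⟩
    | cons a u =>
      have hau : a :: u ∈ L := hL.mem_of_infix ⟨[I 0], [], by simp⟩ hu
      by_cases ha : a = I 0
      · subst ha
        obtain ⟨v, hv⟩ := ih u.length (by simp at h; omega) hau rfl
        exact ⟨I 0 :: v, by simp [subst_cons, ← hv]⟩
      · cases u with
        | nil => exact ⟨[a], by simp [subst_cons, ha]⟩
        | cons b u =>
          have hb : b = I 0 := hL.eq_of_pair_mem ha (hL.mem_of_infix ⟨[I 0], u, by simp⟩ hu)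
          subst hb
          obtain ⟨v, hv⟩ := ih u.length (by simp at h; omega)
            (hL.mem_of_infix ⟨[a], [], by simp⟩ hau) rfl
          exact ⟨a :: v, by simp [subst_cons, ha, ← hv]⟩

/-- A word of the language that begins and ends with the separating symbol is decoded. -/
theorem exists_substExt {u : List A} (hu : u ++ [I 0] ∈ L)
    (hs : u = [] ∨ ∃ t, u = I 0 :: t) : ∃ v, u ++ [I 0] = substExt (I 0) v := by
  rcases hs with rfl | ⟨t, rfl⟩
  · exact ⟨[], rfl⟩
  · obtain ⟨v, hv⟩ := hL.exists_subst_of_cons (u := t) (hL.mem_of_infix ⟨[], [I 0], by simp⟩ hu)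
    exact ⟨v, by rw [hv, substExt]⟩

/-- The right extensions of a coded word correspond to those of the word. A symbol `b` other than
the separating one is followed by that one, which completes the code of `u b`. -/
theorem append_mem_derived_iff (u : List A) (b : A) :
    u ++ [b] ∈ derivedLanguage (I 0) L ↔ substExt (I 0) u ++ [b] ∈ L := by
  have e : substExt (I 0) (u ++ [b]) = if b = I 0 then substExt (I 0) u ++ [b]
      else substExt (I 0) u ++ [b] ++ [I 0] := by
    rw [substExt_append]
    by_cases hb : b = I 0
    · simp [hb, substExt, subst_cons]
    · simp [hb, substExt, subst_cons]
  rw [derivedLanguage, Set.mem_ofPred_eq, e]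
  by_cases hb : b = I 0
  · rw [if_pos hb]
  · rw [if_neg hb]
    refine ⟨hL.mem_of_infix ⟨[], [I 0], by simp⟩, fun h => ?_⟩
    obtain ⟨c, hc⟩ := hL.exists_append_mem h
    have : c = I 0 := hL.eq_of_pair_mem hb
      (hL.mem_of_infix ⟨substExt (I 0) u, [], by simp⟩ hc)
    rwa [this] at hc

theorem cons_mem_derived_iff (a : A) (u : List A) :
    a :: u ∈ derivedLanguage (I 0) L ↔ a :: substExt (I 0) u ∈ L := by
  rw [derivedLanguage, Set.mem_ofPred_eq]
  by_cases ha : a = I 0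
  · rw [ha, substExt_cons_self]
  · rw [substExt_cons_of_ne ha]
    refine ⟨hL.mem_of_infix ⟨[I 0], [], by simp⟩, fun h => ?_⟩
    obtain ⟨c, hc⟩ := hL.exists_cons_mem h
    have : c = I 0 := hL.eq_of_pair_mem_left ha
      (hL.mem_of_infix ⟨[], substExt (I 0) u, by simp⟩ hc)
    rwa [this] at hc

theorem rightSpecial_derived_iff (u : List A) :
    RightSpecialIn (derivedLanguage (I 0) L) u ↔ RightSpecialIn L (substExt (I 0) u) := by
  simp only [RightSpecialIn, hL.append_mem_derived_iff]

theorem leftSpecial_derived_iff (u : List A) :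
    LeftSpecialIn (derivedLanguage (I 0) L) u ↔ LeftSpecialIn L (substExt (I 0) u) := by
  simp only [LeftSpecialIn, hL.cons_mem_derived_iff]

theorem exists_substExt_of_bispecial {u : List A} (hr : RightSpecialIn L u)
    (hl : LeftSpecialIn L u) (h : u ≠ []) : ∃ v, u = substExt (I 0) v := by
  obtain ⟨t, rfl⟩ := hL.exists_eq_append_of_rightSpecial hr h
  obtain ⟨t', ht'⟩ := hL.exists_eq_cons_of_leftSpecial hl h
  obtain ⟨a, b, -, hm, -⟩ := hr
  refine hL.exists_substExt (hL.mem_of_infix ⟨[], [a], by simp⟩ hm) ?_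
  cases t with
  | nil => exact Or.inl rfl
  | cons c t => exact Or.inr ⟨t, by simp at ht'; simp [ht'.1]⟩

theorem derived_left_unique {u v : List A} (hu : LeftSpecialIn (derivedLanguage (I 0) L) u)
    (hv : LeftSpecialIn (derivedLanguage (I 0) L) v) (h : u.length = v.length) : u = v := by
  rw [hL.leftSpecial_derived_iff] at hu hv
  rcases le_total (substExt (I 0) u).length (substExt (I 0) v).length with hle | hle
  · exact (prefix_of_substExt_prefix (hL.prefix_of_leftSpecial hu hv hle)).eq_of_length h
  · exact ((prefix_of_substExt_prefix (hL.prefix_of_leftSpecial hv hu hle)).eq_of_length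
      h.symm).symm

theorem derived_right_unique {u v : List A} (hu : RightSpecialIn (derivedLanguage (I 0) L) u)
    (hv : RightSpecialIn (derivedLanguage (I 0) L) v) (h : u.length = v.length) : u = v := by
  rw [hL.rightSpecial_derived_iff] at hu hv
  rcases le_total (substExt (I 0) u).length (substExt (I 0) v).length with hle | hle
  · exact (suffix_of_substExt_suffix (hL.suffix_of_rightSpecial hu hv hle)).eq_of_length h
  · exact ((suffix_of_substExt_suffix (hL.suffix_of_rightSpecial hv hu hle)).eq_of_length
      h.symm).symm

theorem derived_irreducible {u v : List A} (hu : u ∈ derivedLanguage (I 0) L)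
    (hv : v ∈ derivedLanguage (I 0) L) : ∃ y, u ++ y ++ v ∈ derivedLanguage (I 0) L := by
  obtain ⟨y, hy⟩ := hL.irreducible hu hv
  obtain ⟨z, hz⟩ := hL.exists_subst_of_cons (u := y)
    (hL.mem_of_infix ⟨subst (I 0) u, substExt (I 0) v, by simp [substExt]⟩ hy)
  refine ⟨z, ?_⟩
  have e : substExt (I 0) (u ++ z ++ v) = substExt (I 0) u ++ y ++ substExt (I 0) v := by
    rw [substExt_append, subst_append, ← hz]
    simp [substExt]
  rw [derivedLanguage, Set.mem_ofPred_eq, e]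
  exact hy

theorem derived_mem_of_infix {u v : List A} (h : u <:+: v) (hv : v ∈ derivedLanguage (I 0) L) :
    u ∈ derivedLanguage (I 0) L :=
  hL.mem_of_infix (substExt_infix h) hv

theorem rightSpecial_derived_cons {a : A} {u : List A}
    (h : RightSpecialIn L (a :: substExt (I 0) u)) :
    RightSpecialIn (derivedLanguage (I 0) L) (a :: u) := by
  obtain ⟨b, c, hbc, hb, hc⟩ := h
  have key : ∀ d, a :: substExt (I 0) u ++ [d] ∈ L →
      (a :: u) ++ [d] ∈ derivedLanguage (I 0) L := by
    intro d hd
    rw [hL.append_mem_derived_iff]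
    by_cases ha : a = I 0
    · subst ha
      rwa [substExt_cons_self]
    · rw [substExt_cons_of_ne ha]
      obtain ⟨e, he⟩ := hL.exists_cons_mem hd
      obtain ⟨t, ht⟩ := exists_substExt_eq_cons (I 0) u
      have : e = I 0 := hL.eq_of_pair_mem_left ha
        (hL.mem_of_infix ⟨[], substExt (I 0) u ++ [d], by simp⟩ he)
      rw [this] at he
      exact he
  exact ⟨b, c, hbc, key b hb, key c hc⟩

/-- Desubstitution: the language coded by an Arnoux-Rauzy language is again one, and its index
sequence is shifted by one place. -/
theorem derived : IsARLanguage (derivedLanguage (I 0) L) (fun n => I (n + 1)) where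
  mem_of_infix := hL.derived_mem_of_infix
  irreducible := hL.derived_irreducible
  right_unique := hL.derived_right_unique
  right_full hu a :=
    (hL.append_mem_derived_iff _ _).2 (hL.right_full ((hL.rightSpecial_derived_iff _).1 hu) a)
  left_unique := hL.derived_left_unique
  left_full hu a :=
    (hL.cons_mem_derived_iff _ _).2 (hL.left_full ((hL.leftSpecial_derived_iff _).1 hu) a)
  index := by
    obtain ⟨w, hmono, hrange, hw⟩ := hL.index
    have hbi : ∀ n, RightSpecialIn L (w n) ∧ LeftSpecialIn L (w n) := fun n => by
      have h : w n ∈ {u | RightSpecialIn L u ∧ LeftSpecialIn L u} := hrange ▸ ⟨n, rfl⟩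
      exact h
    have hne : ∀ n, w (n + 1) ≠ [] := fun n h => by
      have := hmono (Nat.succ_pos n)
      simp [h] at this
    choose w' hw' using fun n => hL.exists_substExt_of_bispecial (hbi (n + 1)).1
      (hbi (n + 1)).2 (hne n)
    have hleft : ∀ n, LeftSpecialIn L (substExt (I 0) (w' n)) := fun n =>
      hw' n ▸ (hbi (n + 1)).2
    refine ⟨w', fun m n hmn => ?_, ?_, fun n => ?_⟩
    · -- Left-special words of the derived language are prefixes of each other.
      have hlt : (substExt (I 0) (w' m)).length < (substExt (I 0) (w' n)).length := by
        rw [← hw', ← hw']; exact hmono (Nat.succ_lt_succ hmn)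
      have hpre := prefix_of_substExt_prefix (hL.prefix_of_leftSpecial (hleft m) (hleft n) hlt.le)
      refine lt_of_le_of_ne hpre.length_le fun h => ?_
      rw [hpre.eq_of_length h] at hlt
      exact lt_irrefl _ hlt
    · ext u
      rw [Set.mem_ofPred_eq, hL.rightSpecial_derived_iff, hL.leftSpecial_derived_iff]
      constructor
      · rintro ⟨n, rfl⟩
        rw [← hw']
        exact hbi (n + 1)
      · intro hu
        obtain ⟨m, hm⟩ : substExt (I 0) u ∈ Set.range w := by rw [hrange]; exact hu
        cases m with
        | zero =>
          obtain ⟨k, hk⟩ : [] ∈ Set.range w := by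
            rw [hrange]
            exact ⟨hL.rightSpecial_of_suffix List.nil_suffix hu.1,
              hL.leftSpecial_of_prefix List.nil_prefix hu.2⟩
          have h0 := hmono.monotone (Nat.zero_le k)
          simp only [hk, hm] at h0
          exact absurd (List.eq_nil_of_length_eq_zero (Nat.le_zero.1 h0)) (substExt_ne_nil _ _)
        | succ n => exact ⟨n, substExt_injective (I 0) ((hw' n).symm.trans hm)⟩
    · refine hL.rightSpecial_derived_cons ?_
      rw [← hw']
      exact hw (n + 1)

/-- A word of the language that contains the separating symbol is, up to at most one symbol on
either side, decoded. -/
theorem exists_trim {v : List A} (hv : v ∈ L) (hs : I 0 ∈ v) :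
    ∃ α u β, α.length ≤ 1 ∧ β.length ≤ 1 ∧ v = α ++ substExt (I 0) u ++ β := by
  obtain ⟨α, y, hα, hvy⟩ : ∃ α y, α.length ≤ 1 ∧ v = α ++ I 0 :: y := by
    cases v with
    | nil => simp at hs
    | cons a v =>
      by_cases ha : a = I 0
      · exact ⟨[], v, by simp, by simp [ha]⟩
      · cases v with
        | nil => simp [Ne.symm ha] at hs
        | cons b v =>
          have : b = I 0 := hL.eq_of_pair_mem ha (hL.mem_of_infix ⟨[], v, by simp⟩ hv)
          exact ⟨[a], v, by simp, by simp [this]⟩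
  obtain ⟨x, β, hβ, hxy⟩ : ∃ x β, β.length ≤ 1 ∧ I 0 :: y = x ++ [I 0] ++ β := by
    rcases List.eq_nil_or_concat y with rfl | ⟨y, b, rfl⟩
    · exact ⟨[], [], by simp, by simp⟩
    · by_cases hb : b = I 0
      · exact ⟨I 0 :: y, [], by simp, by simp [hb]⟩
      · rcases List.eq_nil_or_concat y with rfl | ⟨y, c, rfl⟩
        · exact ⟨[], [b], by simp, by simp⟩
        · have : c = I 0 := hL.eq_of_pair_mem_left hb
            (hL.mem_of_infix ⟨α ++ I 0 :: y, [], by simp [hvy]⟩ hv)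
          exact ⟨I 0 :: y, [b], by simp, by simp [this]⟩
  obtain ⟨u, hu⟩ := hL.exists_substExt (u := x)
    (hL.mem_of_infix ⟨α, β, by simp [hvy, hxy]⟩ hv) (by
      cases x with
      | nil => exact Or.inl rfl
      | cons c x => exact Or.inr ⟨x, by simp at hxy; simp [hxy.1]⟩)
  exact ⟨α, u, β, hα, hβ, by rw [hvy, hxy, hu]; simp⟩

end IsARLanguage

end Substitution

/-! ### Iterated substitutions -/

section Iterate

variable {A : Type*} [DecidableEq A]

/-- The word `τ₀ ⋯ τₘ₋₁(u) wₘ`, where `τᵢ` is the substitution with separating symbol `I i` and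
`wₘ` the bispecial word number `m` of the language with index sequence `I`. -/
def iterSubst (I : ℕ → A) : ℕ → List A → List A
  | 0, u => u
  | m + 1, u => iterSubst I m (substExt (I m) u)

/-- The length of `τ₀ ⋯ τₘ₋₁(a)`. -/
def blockLength (I : ℕ → A) : ℕ → A → ℕ
  | 0, _ => 1
  | m + 1, a => if a = I m then blockLength I m a else blockLength I m (I m) + blockLength I m a

/-- The length of `τ₀ ⋯ τₘ₋₁(I m)`, a period of the bispecial word number `m + 1`. -/
def period (I : ℕ → A) (m : ℕ) : ℕ := blockLength I m (I m)

/-- The length of the bispecial word number `m`. -/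
def bispecialLength (I : ℕ → A) (m : ℕ) : ℕ := ∑ i ∈ Finset.range m, period I i

theorem bispecialLength_succ (I : ℕ → A) (m : ℕ) :
    bispecialLength I (m + 1) = bispecialLength I m + period I m := Finset.sum_range_succ _ _

theorem sum_blockLength_subst (I : ℕ → A) (m : ℕ) (u : List A) :
    ((subst (I m) u).map (blockLength I m)).sum = (u.map (blockLength I (m + 1))).sum := by
  induction u with
  | nil => rfl
  | cons a u ih =>
    rw [subst_cons, List.map_append, List.sum_append, ih, List.map_cons, List.sum_cons,
      blockLength]
    by_cases h : a = I m <;> simp [h]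

theorem length_iterSubst (I : ℕ → A) (m : ℕ) (u : List A) :
    (iterSubst I m u).length = bispecialLength I m + (u.map (blockLength I m)).sum := by
  induction m generalizing u with
  | zero => simp [iterSubst, bispecialLength, blockLength]
  | succ m ih =>
    rw [iterSubst, ih, substExt, List.map_append, List.sum_append, sum_blockLength_subst,
      bispecialLength_succ, period]
    simp
    ring

theorem iterSubst_prefix (I : ℕ → A) (m : ℕ) {u v : List A} (h : u <+: v) :
    iterSubst I m u <+: iterSubst I m v := by
  induction m generalizing u v with
  | zero => exact h
  | succ m ih =>
    obtain ⟨t, rfl⟩ := h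
    exact ih (substExt_prefix_append _ _ _)

theorem iterSubst_suffix (I : ℕ → A) (m : ℕ) {u v : List A} (h : u <:+ v) :
    iterSubst I m u <:+ iterSubst I m v := by
  induction m generalizing u v with
  | zero => exact h
  | succ m ih =>
    obtain ⟨t, rfl⟩ := h
    exact ih (substExt_suffix_append _ _ _)

theorem iterSubst_infix (I : ℕ → A) (m : ℕ) {u v : List A} (h : u <:+: v) :
    iterSubst I m u <:+: iterSubst I m v := by
  obtain ⟨a, b, rfl⟩ := h
  exact (iterSubst_suffix I m ⟨a, rfl⟩).isInfix.trans (iterSubst_prefix I m ⟨b, rfl⟩).isInfix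

theorem length_iterSubst_pair (I : ℕ → A) (m : ℕ) :
    (iterSubst I m [I m, I m]).length = 2 * period I m + bispecialLength I m := by
  rw [length_iterSubst, period]
  simp
  ring

/-- The image of the square of the separating symbol has the image of that symbol as a period:
both its prefix and its suffix of the complementary length are the extended image of the symbol. -/
theorem iterSubst_pair_periodic (I : ℕ → A) (m i : ℕ)
    (hi : i < period I m + bispecialLength I m) :
    (iterSubst I m [I m, I m])[i + period I m]? = (iterSubst I m [I m, I m])[i]? := by
  obtain ⟨t, ht⟩ := iterSubst_prefix I m (u := [I m]) (v := [I m, I m]) ⟨[I m], rfl⟩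
  obtain ⟨t', ht'⟩ := iterSubst_suffix I m (u := [I m]) (v := [I m, I m]) ⟨[I m], rfl⟩
  have h1 : (iterSubst I m [I m]).length = period I m + bispecialLength I m := by
    rw [length_iterSubst, period]; simp; ring
  have h2 : t'.length = period I m := by
    have := congrArg List.length ht'
    rw [List.length_append, length_iterSubst_pair, h1] at this
    omega
  conv_lhs => rw [← ht']
  conv_rhs => rw [← ht]
  rw [List.getElem?_append_right (by omega), List.getElem?_append_left (by omega), h2,
    Nat.add_sub_cancel]

/-- The language that is coded by `L` through the first `m` substitutions. -/
def iteratedLanguage (L : Set (List A)) (I : ℕ → A) (m : ℕ) : Set (List A) :=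
  {u | iterSubst I m u ∈ L}

theorem IsARLanguage.iterated {L : Set (List A)} {I : ℕ → A} (hL : IsARLanguage L I) (m : ℕ) :
    IsARLanguage (iteratedLanguage L I m) (fun n => I (m + n)) := by
  induction m with
  | zero =>
    have e : (fun n => I (0 + n)) = I := by funext n; rw [zero_add]
    rw [e]
    exact hL
  | succ m ih =>
    have h := ih.derived
    have e : (fun n => I (m + (n + 1))) = fun n => I (m + 1 + n) := by
      funext n; congr 1; ring
    rw [e] at h
    exact h

end Iterate

/-! ### The Tribonacci case -/

section Tribonacci

/-- The Tribonacci numbers `1, 2, 4, 7, 13, …`. -/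
abbrev tribPeriod : ℕ → ℕ := period tribonacciIndex

/-- The lengths `0, 1, 3, 7, 14, …` of the bispecial words of the Tribonacci subshift. -/
abbrev tribLength : ℕ → ℕ := bispecialLength tribonacciIndex

theorem tribonacciIndex_add_three (m : ℕ) : tribonacciIndex (m + 3) = tribonacciIndex m := by
  simp [tribonacciIndex]

theorem tribonacciIndex_distinct (m : ℕ) : tribonacciIndex m ≠ tribonacciIndex (m + 1) ∧
    tribonacciIndex m ≠ tribonacciIndex (m + 2) ∧
    tribonacciIndex (m + 1) ≠ tribonacciIndex (m + 2) := by
  simp only [tribonacciIndex, ne_eq, Fin.mk.injEq]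
  omega

theorem eq_tribonacciIndex (m : ℕ) (c : Fin 3) : c = tribonacciIndex m ∨
    c = tribonacciIndex (m + 1) ∨ c = tribonacciIndex (m + 2) := by
  simp only [tribonacciIndex, Fin.ext_iff]
  have := c.isLt
  omega

theorem tribPeriod_succ (m : ℕ) : tribPeriod (m + 1) =
    blockLength tribonacciIndex m (tribonacciIndex m) +
      blockLength tribonacciIndex m (tribonacciIndex (m + 1)) := by
  simp only [tribPeriod, period, blockLength]
  rw [if_neg (tribonacciIndex_distinct m).1.symm]

theorem tribPeriod_add_two (m : ℕ) : tribPeriod (m + 2) = tribPeriod (m + 1) +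
    (blockLength tribonacciIndex m (tribonacciIndex m) +
      blockLength tribonacciIndex m (tribonacciIndex (m + 2))) := by
  rw [tribPeriod_succ (m + 1)]
  congr 1
  rw [show m + 1 + 1 = m + 2 from rfl, blockLength, if_neg (tribonacciIndex_distinct m).2.1.symm]

theorem tribPeriod_add_three (m : ℕ) :
    tribPeriod (m + 3) = tribPeriod (m + 2) + tribPeriod (m + 1) + tribPeriod m := by
  obtain ⟨h1, h2, h3⟩ := tribonacciIndex_distinct m
  rw [tribPeriod_succ (m + 2), show m + 2 + 1 = m + 3 from rfl, tribonacciIndex_add_three,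
    add_assoc]
  congr 1
  have e1 : blockLength tribonacciIndex (m + 2) (tribonacciIndex m) =
      tribPeriod (m + 1) + blockLength tribonacciIndex (m + 1) (tribonacciIndex m) := by
    rw [blockLength, if_neg h1]; rfl
  have e2 : blockLength tribonacciIndex (m + 1) (tribonacciIndex m) = tribPeriod m := by
    rw [blockLength, if_pos rfl]; rfl
  rw [e1, e2]

theorem tribPeriod_lt_succ (m : ℕ) : tribPeriod m < tribPeriod (m + 1) := by
  have hpos : ∀ (m : ℕ) (a : Fin 3), 0 < blockLength tribonacciIndex m a := by
    intro m
    induction m with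
    | zero => intro a; simp [blockLength]
    | succ m ih =>
      intro a
      have := ih a
      rw [blockLength]
      split_ifs <;> omega
  rw [tribPeriod_succ]
  exact Nat.lt_add_of_pos_right (hpos _ _)

theorem tribPeriod_strictMono : StrictMono tribPeriod :=
  strictMono_nat_of_lt_succ tribPeriod_lt_succ

theorem tribPeriod_pos (m : ℕ) : 0 < tribPeriod m := by
  have : tribPeriod 0 = 1 := rfl
  have := tribPeriod_strictMono.monotone (Nat.zero_le m)
  omega

theorem tribPeriod_succ_le (m : ℕ) : tribPeriod (m + 1) ≤ 2 * tribPeriod m := by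
  match m with
  | 0 => decide
  | 1 => decide
  | 2 => decide
  | m + 3 =>
    have h1 := tribPeriod_add_three m
    have h2 := tribPeriod_add_three (m + 1)
    simp only [Nat.add_assoc, Nat.reduceAdd] at h2 ⊢
    omega

theorem blockLength_le_tribPeriod (m : ℕ) (c : Fin 3) :
    blockLength tribonacciIndex m c ≤ tribPeriod (m + 2) := by
  have h1 := tribPeriod_succ m
  have h2 := tribPeriod_add_two m
  rcases eq_tribonacciIndex m c with rfl | rfl | rfl <;> omega

theorem tribLength_succ (m : ℕ) : tribLength (m + 1) = tribLength m + tribPeriod m :=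
  bispecialLength_succ _ _

theorem tribLength_le (m : ℕ) : tribLength m ≤ 2 * tribPeriod m := by
  induction m with
  | zero => simp [bispecialLength]
  | succ m ih =>
    have h : 3 * tribPeriod m ≤ 2 * tribPeriod (m + 1) := by
      match m with
      | 0 => decide
      | 1 => decide
      | m + 2 =>
        have h1 := tribPeriod_add_three m
        have h2 := tribPeriod_succ_le (m + 1)
        simp only [Nat.add_assoc, Nat.reduceAdd] at h2 ⊢
        omega
    rw [tribLength_succ]
    omega

/-- The bispecial words exceed the periods by a definite proportion. This is where the Tribonacci
words have powers with exponent larger than three. -/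
theorem add_le_tribLength (m : ℕ) :
    tribPeriod (m + 4) + tribPeriod m ≤ tribLength (m + 4) := by
  have h0 := tribLength_succ m
  have h1 := tribLength_succ (m + 1)
  have h2 := tribLength_succ (m + 2)
  have h3 := tribLength_succ (m + 3)
  have h4 := tribPeriod_add_three (m + 1)
  simp only [Nat.add_assoc, Nat.reduceAdd] at h1 h2 h3 h4 ⊢
  omega

/-- The square of the separating symbol appears in the code of every symbol four levels further on:
the code begins with `s`, and going down it then contains in turn `s b`, `s a` and `s s`, where
`s, a, b` are the separating symbols of the first three levels. -/
theorem iterSubst_pair_infix (m : ℕ) (c : Fin 3) :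
    iterSubst tribonacciIndex m [tribonacciIndex m, tribonacciIndex m] <:+:
      iterSubst tribonacciIndex (m + 4) [c] := by
  obtain ⟨h1, h2, h3⟩ := tribonacciIndex_distinct m
  have e3 : [tribonacciIndex m] <:+: substExt (tribonacciIndex (m + 3)) [c] := by
    obtain ⟨t, ht⟩ := exists_substExt_eq_cons (tribonacciIndex (m + 3)) [c]
    rw [ht, tribonacciIndex_add_three]
    exact ⟨[], t, by simp⟩
  have e2 : [tribonacciIndex m, tribonacciIndex (m + 2)] <:+:
      substExt (tribonacciIndex (m + 2)) [tribonacciIndex m] :=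
    ⟨[tribonacciIndex (m + 2)], [], by simp [substExt, subst_cons, h2]⟩
  have e1 : [tribonacciIndex m, tribonacciIndex (m + 1)] <:+:
      substExt (tribonacciIndex (m + 1)) [tribonacciIndex m, tribonacciIndex (m + 2)] :=
    ⟨[tribonacciIndex (m + 1)], [tribonacciIndex (m + 2), tribonacciIndex (m + 1)], by
      simp [substExt, subst_cons, h1, h3.symm]⟩
  have e0 : [tribonacciIndex m, tribonacciIndex m] <:+:
      substExt (tribonacciIndex m) [tribonacciIndex m, tribonacciIndex (m + 1)] :=
    ⟨[], [tribonacciIndex (m + 1), tribonacciIndex m], by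
      simp [substExt, subst_cons, h1.symm]⟩
  refine iterSubst_infix tribonacciIndex m (e0.trans (substExt_infix (e1.trans
    (substExt_infix (e2.trans (substExt_infix e3))))))

/-- Every long word of a Tribonacci language contains, up to short pieces at its ends, the image of
a word under the first `m` substitutions. -/
theorem exists_iterSubst_infix {L : Set (List (Fin 3))} (hL : IsARLanguage L tribonacciIndex)
    {v : List (Fin 3)} (hv : v ∈ L) (m : ℕ)
    (hm : tribLength m + tribPeriod (m + 2) + 2 * tribLength (m + 2) < v.length) :
    ∃ u, iterSubst tribonacciIndex m u <:+: v ∧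
      v.length ≤ (iterSubst tribonacciIndex m u).length + 2 * tribLength (m + 2) := by
  induction m with
  | zero => exact ⟨v, List.infix_refl _, by rw [iterSubst]; omega⟩
  | succ m ih =>
    have k1 := tribLength_succ m
    have k2 := tribLength_succ (m + 2)
    have k3 := tribPeriod_lt_succ (m + 2)
    simp only [Nat.add_assoc, Nat.reduceAdd] at k2 k3 hm ⊢
    obtain ⟨u, hu, hlen⟩ := ih (by omega)
    have hum : u ∈ iteratedLanguage L tribonacciIndex m := hL.mem_of_infix hu hv
    have hlang := hL.iterated m
    -- A word without the separating symbol has at most one symbol, so its image is too short.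
    have hs : tribonacciIndex m ∈ u := by
      by_contra hs
      have h1 := hlang.length_le_one_of_notMem hum hs
      have h2 : (iterSubst tribonacciIndex m u).length ≤ tribLength m + tribPeriod (m + 2) := by
        rw [length_iterSubst]
        refine Nat.add_le_add_left ?_ _
        match u, h1 with
        | [], _ => simp
        | [c], _ => simpa using blockLength_le_tribPeriod m c
      omega
    obtain ⟨α, u', β, hα, hβ, rfl⟩ := hlang.exists_trim hum hs
    refine ⟨u', (iterSubst_infix _ m ⟨α, β, rfl⟩).trans hu, ?_⟩
    have hshort : ∀ α : List (Fin 3), α.length ≤ 1 →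
        (α.map (blockLength tribonacciIndex m)).sum ≤ tribPeriod (m + 2) := by
      intro α hα
      match α, hα with
      | [], _ => simp
      | [c], _ => simpa using blockLength_le_tribPeriod m c
    have l1 := hshort α hα
    have l2 := hshort β hβ
    have l3 := length_iterSubst tribonacciIndex m (α ++ substExt (tribonacciIndex m) u' ++ β)
    have l4 := length_iterSubst tribonacciIndex m (substExt (tribonacciIndex m) u')
    simp only [List.map_append, List.sum_append] at l3
    simp only [Nat.add_zero] at hlen l3 l4
    rw [iterSubst]
    omega

/-- The word with period `tribPeriod m` that is coded by the square of the separating symbol occurs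
with gaps bounded by a constant multiple of its period. -/
theorem iterSubst_pair_infix_of_long {L : Set (List (Fin 3))}
    (hL : IsARLanguage L tribonacciIndex) {v : List (Fin 3)} (hv : v ∈ L) (m : ℕ)
    (hm : 353 * tribPeriod m ≤ v.length) :
    iterSubst tribonacciIndex m [tribonacciIndex m, tribonacciIndex m] <:+: v := by
  -- With `p = tribPeriod m`, the bound needed at level `m + 4` is at most `32 p + 64 p + 256 p`.
  have a1 := tribPeriod_succ_le m
  have a2 := tribPeriod_succ_le (m + 1)
  have a3 := tribPeriod_succ_le (m + 2)
  have a4 := tribPeriod_succ_le (m + 3)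
  have a5 := tribPeriod_succ_le (m + 4)
  have a6 := tribPeriod_succ_le (m + 5)
  have b1 := tribLength_le (m + 4)
  have b2 := tribLength_le (m + 6)
  have c := tribPeriod_pos m
  simp only [Nat.add_assoc, Nat.reduceAdd] at a2 a3 a4 a5 a6
  obtain ⟨u, hu, hlen⟩ := exists_iterSubst_infix hL hv (m + 4) (by
    simp only [Nat.add_assoc, Nat.reduceAdd]; omega)
  simp only [Nat.add_assoc, Nat.reduceAdd] at hlen
  cases u with
  | nil =>
    have h : (iterSubst tribonacciIndex (m + 4) []).length = tribLength (m + 4) := by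
      rw [length_iterSubst]; simp
    omega
  | cons a u =>
    exact (iterSubst_pair_infix m a).trans ((iterSubst_infix _ _ ⟨[], u, rfl⟩).trans hu)

end Tribonacci

/-! ### The language of an Arnoux-Rauzy sequence -/

section Factors

variable {A : Type*}

@[simp] theorem length_word (x : ℤ → A) (j : ℤ) (n : ℕ) : (word x j n).length = n := by
  simp [word]

theorem word_add (x : ℤ → A) (j : ℤ) (m n : ℕ) :
    word x j (m + n) = word x j m ++ word x (j + m) n := by
  refine List.ext_getElem (by simp) fun i h1 h2 => ?_
  by_cases hi : i < m
  · rw [List.getElem_append_left (by simpa using hi)]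
    simp [word]
  · rw [List.getElem_append_right (by simpa using hi)]
    simp only [word, List.getElem_ofFn, List.length_ofFn]
    congr 1
    push_cast [Nat.cast_sub (not_lt.1 hi)]
    ring

theorem word_getElem? (x : ℤ → A) (j : ℤ) {n i : ℕ} (hi : i < n) :
    (word x j n)[i]? = some (x (j + i)) := by
  rw [List.getElem?_eq_getElem (by simpa using hi)]
  simp [word]

theorem mem_factors_iff (x : ℤ → A) (u : List A) :
    u ∈ factors x ↔ ∃ j, word x j u.length = u := by
  constructor
  · intro h
    obtain ⟨n, j, rfl⟩ := Set.mem_iUnion.1 h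
    exact ⟨j, by simp⟩
  · rintro ⟨j, hj⟩
    exact Set.mem_iUnion.2 ⟨u.length, j, hj⟩

theorem mem_factorsOfLength_iff (x : ℤ → A) (n : ℕ) (u : List A) :
    u ∈ factorsOfLength x n ↔ u ∈ factors x ∧ u.length = n := by
  rw [mem_factors_iff]
  constructor
  · rintro ⟨j, rfl⟩
    exact ⟨⟨j, by simp⟩, by simp⟩
  · rintro ⟨⟨j, hj⟩, rfl⟩
    exact ⟨j, hj⟩

theorem word_mem_factors (x : ℤ → A) (j : ℤ) (n : ℕ) : word x j n ∈ factors x :=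
  (mem_factors_iff x _).2 ⟨j, by simp⟩

theorem exists_word_of_infix {x : ℤ → A} {u : List A} {j : ℤ} {n : ℕ} (h : u <:+: word x j n) :
    ∃ i : ℕ, i + u.length ≤ n ∧ word x (j + i) u.length = u := by
  obtain ⟨a, b, hab⟩ := h
  have hn : n = a.length + u.length + b.length := by
    have := congrArg List.length hab
    simp only [List.length_append, length_word] at this
    exact this.symm
  refine ⟨a.length, by omega, ?_⟩
  rw [hn, word_add, word_add] at hab
  have h1 := (List.append_inj hab (by simp)).1
  exact (List.append_inj h1 (by simp)).2.symm

theorem mem_factors_of_infix {x : ℤ → A} {u v : List A} (h : u <:+: v) (hv : v ∈ factors x) :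
    u ∈ factors x := by
  obtain ⟨j, hj⟩ := (mem_factors_iff x v).1 hv
  rw [← hj] at h
  obtain ⟨i, -, hi⟩ := exists_word_of_infix h
  exact (mem_factors_iff x u).2 ⟨_, hi⟩

/-- If a finite set of words is extended by single symbols of a three-letter alphabet in at least
two more ways than it has elements, and only one word `r` has several extensions, then `r` has all
three of them. -/
theorem extension_full {F F' : Set (List (Fin 3))} (g : List (Fin 3) → Fin 3 → List (Fin 3))
    (hF : F.Finite) (hcard : F.ncard + 2 ≤ F'.ncard) (hsurj : ∀ v ∈ F', ∃ u ∈ F, ∃ d, v = g u d)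
    (hext : ∀ u ∈ F, ∃ a, g u a ∈ F') {r : List (Fin 3)} (hr : r ∈ F)
    (huniq : ∀ u ∈ F, ∀ a b, a ≠ b → g u a ∈ F' → g u b ∈ F' → u = r) (c : Fin 3) :
    g r c ∈ F' := by
  classical
  by_contra hc
  choose! e he using hext
  have third : ∀ c e : Fin 3, e ≠ c → ∃ b, ∀ d, d ≠ c → d = e ∨ d = b := by decide
  obtain ⟨b, hb⟩ := third c (e r) fun h => hc (h ▸ he r hr)
  have hsub : F' ⊆ (fun u => g u (e u)) '' F ∪ {g r b} := by
    intro v hv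
    obtain ⟨u, hu, d, rfl⟩ := hsurj v hv
    by_cases hd : d = e u
    · exact Or.inl ⟨u, hu, by rw [hd]⟩
    · obtain rfl := huniq u hu d (e u) hd hv (he u hu)
      rcases hb d fun h => hc (h ▸ hv) with h | h
      · exact absurd h hd
      · exact Or.inr (by rw [h]; rfl)
  have h1 := Set.ncard_le_ncard hsub ((hF.image _).union (Set.finite_singleton _))
  have h2 := Set.ncard_union_le ((fun u => g u (e u)) '' F) {g r b}
  have h3 := Set.ncard_image_le (f := fun u => g u (e u)) hF
  rw [Set.ncard_singleton] at h2
  omega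

theorem IsArnouxRauzy.rightSpecial_unique {k : ℕ} {x : ℤ → Fin k} (hx : IsArnouxRauzy x)
    {u v : List (Fin k)} (hu : IsRightSpecial x u) (hv : IsRightSpecial x v)
    (h : u.length = v.length) : u = v := by
  have key : ∀ w, IsRightSpecial x w → w ∈ factors x := fun w ⟨a, _, _, ha, _⟩ =>
    mem_factors_of_infix ⟨[], [a], by simp⟩ ha
  exact (hx.rightSpecial u.length).unique
    ⟨(mem_factorsOfLength_iff _ _ _).2 ⟨key u hu, rfl⟩, hu⟩
    ⟨(mem_factorsOfLength_iff _ _ _).2 ⟨key v hv, h.symm⟩, hv⟩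

theorem IsArnouxRauzy.leftSpecial_unique {k : ℕ} {x : ℤ → Fin k} (hx : IsArnouxRauzy x)
    {u v : List (Fin k)} (hu : IsLeftSpecial x u) (hv : IsLeftSpecial x v)
    (h : u.length = v.length) : u = v := by
  have key : ∀ w, IsLeftSpecial x w → w ∈ factors x := fun w ⟨a, _, _, ha, _⟩ =>
    mem_factors_of_infix ⟨[a], [], by simp⟩ ha
  exact (hx.leftSpecial u.length).unique
    ⟨(mem_factorsOfLength_iff _ _ _).2 ⟨key u hu, rfl⟩, hu⟩
    ⟨(mem_factorsOfLength_iff _ _ _).2 ⟨key v hv, h.symm⟩, hv⟩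

theorem IsArnouxRauzy.finite_factorsOfLength {k : ℕ} {x : ℤ → Fin k} (hx : IsArnouxRauzy x)
    (n : ℕ) : (factorsOfLength x n).Finite :=
  Set.finite_of_ncard_ne_zero (by rw [hx.complexity]; omega)

theorem IsArnouxRauzy.right_full {x : ℤ → Fin 3} (hx : IsArnouxRauzy x) {r : List (Fin 3)}
    (hr : IsRightSpecial x r) (c : Fin 3) : r ++ [c] ∈ factors x := by
  obtain ⟨a, b, -, ha, -⟩ := id hr
  have hmem : ∀ (u : List (Fin 3)) (d : Fin 3), u.length = r.length → u ++ [d] ∈ factors x →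
      u ++ [d] ∈ factorsOfLength x (r.length + 1) := fun u d hu h =>
    (mem_factorsOfLength_iff _ _ _).2 ⟨h, by simp [hu]⟩
  refine ((mem_factorsOfLength_iff x (r.length + 1) _).1
    (extension_full (F := factorsOfLength x r.length) (fun u d => u ++ [d])
      (hx.finite_factorsOfLength _) ?_ ?_ ?_ ?_ ?_ c)).1
  · rw [hx.complexity, hx.complexity]; omega
  · rintro _ ⟨j, rfl⟩
    exact ⟨word x j r.length, ⟨j, rfl⟩, x (j + r.length), by
      simp only [word_add]; simp [word]⟩
  · rintro _ ⟨j, rfl⟩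
    refine ⟨x (j + r.length), j, ?_⟩
    simp only [word_add]
    simp [word]
  · exact (mem_factorsOfLength_iff _ _ _).2
      ⟨mem_factors_of_infix ⟨[], [a], by simp⟩ ha, rfl⟩
  · intro u hu a b hab ha hb
    exact hx.rightSpecial_unique ⟨a, b, hab, ((mem_factorsOfLength_iff _ _ _).1 ha).1,
      ((mem_factorsOfLength_iff _ _ _).1 hb).1⟩ hr ((mem_factorsOfLength_iff _ _ _).1 hu).2

theorem IsArnouxRauzy.left_full {x : ℤ → Fin 3} (hx : IsArnouxRauzy x) {r : List (Fin 3)}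
    (hr : IsLeftSpecial x r) (c : Fin 3) : c :: r ∈ factors x := by
  obtain ⟨a, b, -, ha, -⟩ := id hr
  refine ((mem_factorsOfLength_iff x (1 + r.length) _).1
    (extension_full (F := factorsOfLength x r.length) (fun u d => d :: u)
      (hx.finite_factorsOfLength _) ?_ ?_ ?_ ?_ ?_ c)).1
  · rw [hx.complexity, hx.complexity]; omega
  · rintro _ ⟨j, rfl⟩
    exact ⟨word x (j + 1) r.length, ⟨j + 1, rfl⟩, x j, by
      simp only [word_add]; simp [word]⟩
  · rintro _ ⟨j, rfl⟩
    refine ⟨x (j - 1), j - 1, ?_⟩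
    simp only [word_add]
    simp [word]
  · exact (mem_factorsOfLength_iff _ _ _).2
      ⟨mem_factors_of_infix ⟨[a], [], by simp⟩ ha, rfl⟩
  · intro u hu a b hab ha hb
    exact hx.leftSpecial_unique ⟨a, b, hab, ((mem_factorsOfLength_iff _ _ _).1 ha).1,
      ((mem_factorsOfLength_iff _ _ _).1 hb).1⟩ hr ((mem_factorsOfLength_iff _ _ _).1 hu).2

theorem IsArnouxRauzy.isARLanguage {x : ℤ → Fin 3} (hx : IsArnouxRauzy x) {I : ℕ → Fin 3}
    (hI : IsIndexSequence x I) : IsARLanguage (factors x) I where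
  mem_of_infix := mem_factors_of_infix
  irreducible {u v} hu hv := by
    obtain ⟨j, hj⟩ := (mem_factors_iff x u).1 hu
    obtain ⟨l, hl⟩ := hx.uniformlyRecurrent v hv
    obtain ⟨m, hm, -, hmv⟩ := hl (j + u.length)
    obtain ⟨d, hd⟩ := Int.eq_ofNat_of_zero_le (sub_nonneg.2 hm)
    refine ⟨word x (j + u.length) d, ?_⟩
    have e : j + ((u.length + d : ℕ) : ℤ) = m := by push_cast; omega
    have h := word_mem_factors x j (u.length + d + v.length)
    rwa [word_add, word_add, e, hj, hmv] at h
  right_unique := hx.rightSpecial_unique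
  right_full := hx.right_full
  left_unique := hx.leftSpecial_unique
  left_full := hx.left_full
  index := hI

theorem factors_eq_of_mem_subshift {x y : ℤ → A} (h : y ∈ subshift x) : factors y = factors x := by
  rw [factors, factors]
  exact Set.iUnion_congr h

theorem exists_isARLanguage {X : Set (ℤ → Fin 3)} (hX : IsTribonacciSubshift X) :
    ∃ L, IsARLanguage L tribonacciIndex ∧ ∀ x ∈ X, factors x = L := by
  obtain ⟨x, hx, hI, rfl⟩ := hX
  exact ⟨factors x, hx.isARLanguage hI, fun y hy => factors_eq_of_mem_subshift hy⟩

/-! ### The density of three-block repetitions -/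

/-- The sequences in which a block of length `p` is repeated on the three consecutive blocks whose
middle one begins at the origin. -/
def cubeSet (A : Type*) (p : ℕ) : Set (ℤ → A) :=
  {x | ∀ k : ℤ, -p ≤ k → k < p → x (k + p) = x k}

theorem shift_iterate (x : ℤ → A) (n : ℕ) (k : ℤ) : (shift^[n] x) k = x (k + n) := by
  induction n generalizing k with
  | zero => simp
  | succ n ih =>
    rw [Function.iterate_succ_apply', shift, ih]
    congr 1
    push_cast
    ring

/-- In every sequence of the Tribonacci subshift, among `5648 p` consecutive positions at least `p`
are centres of three-block repetitions. The period of the blocks is the Tribonacci number four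
places after `p`, which is at most `16 p`, and `5648 = 353 * 16`. -/
theorem exists_many_cubes {L : Set (List (Fin 3))} (hL : IsARLanguage L tribonacciIndex)
    {x : ℤ → Fin 3} (hx : factors x = L) (n : ℕ) :
    ∃ i : ℕ, i + tribPeriod n ≤ 5648 * tribPeriod n ∧
      ∀ k < tribPeriod n, shift^[i + k] x ∈ cubeSet (Fin 3) (tribPeriod (n + 4)) := by
  set m := n + 4 with hm
  set p := tribPeriod m with hp
  have hinf := iterSubst_pair_infix_of_long hL
    (hx ▸ word_mem_factors x 0 (353 * p)) m (by simp [hp])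
  obtain ⟨i, hi, hword⟩ := exists_word_of_infix hinf
  rw [zero_add] at hword
  have hlen : (iterSubst tribonacciIndex m [tribonacciIndex m, tribonacciIndex m]).length =
      2 * p + tribLength m := length_iterSubst_pair _ _
  have hlong : p + tribPeriod n ≤ tribLength m := add_le_tribLength n
  have a1 := tribPeriod_succ_le n
  have a2 := tribPeriod_succ_le (n + 1)
  have a3 := tribPeriod_succ_le (n + 2)
  have a4 := tribPeriod_succ_le (n + 3)
  simp only [Nat.add_assoc, Nat.reduceAdd] at a2 a3 a4
  rw [← hm, ← hp] at a4
  rw [hlen] at hi hword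
  refine ⟨i + p, by omega, fun k hk j hj1 hj2 => ?_⟩
  rw [shift_iterate, shift_iterate]
  obtain ⟨l, hl⟩ := Int.eq_ofNat_of_zero_le (show 0 ≤ j + p + k by omega)
  have hper := iterSubst_pair_periodic tribonacciIndex m l
    (show l < p + tribLength m by omega)
  rw [← hword, show period tribonacciIndex m = p from rfl, word_getElem? _ _ (by omega),
    word_getElem? _ _ (by omega), Option.some_inj] at hper
  have e1 : j + p + ((i + p + k : ℕ) : ℤ) = i + ((l + p : ℕ) : ℤ) := by push_cast; omega
  have e2 : j + ((i + p + k : ℕ) : ℤ) = i + (l : ℤ) := by push_cast; omega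
  rw [e1, e2, hper]

end Factors

/-! ### Solutions of the eigenvalue equation over repeated blocks -/

/-- The entries of the transfer matrix over a block of `p` sites with coefficients `q`. The matrix
has determinant one, and moves every solution across any place where the block is read. -/
theorem exists_transfer (q : ℕ → ℂ) (p : ℕ) :
    ∃ a b c d : ℂ, a * d - b * c = 1 ∧
      ∀ (φ : ℤ → ℂ) (j : ℤ), (∀ k : ℕ, k < p →
        φ (j + k + 1) = q k * φ (j + k) - φ (j + k - 1)) →
        φ (j + p) = a * φ j + b * φ (j - 1) ∧ φ (j + p - 1) = c * φ j + d * φ (j - 1) := by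
  induction p with
  | zero => exact ⟨1, 0, 0, 1, by norm_num, fun φ j _ => by simp⟩
  | succ p ih =>
    obtain ⟨a, b, c, d, hdet, h⟩ := ih
    refine ⟨q p * a - c, q p * b - d, a, b, by linear_combination hdet, fun φ j hφ => ?_⟩
    obtain ⟨h1, h2⟩ := h φ j fun k hk => hφ k (by omega)
    have h3 := hφ p (by omega)
    have e1 : j + ((p + 1 : ℕ) : ℤ) = j + p + 1 := by push_cast; ring
    have e2 : j + (p : ℤ) + 1 - 1 = j + p := by ring
    rw [e1, e2, h3, h1, h2]
    exact ⟨by ring, rfl⟩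

/-- **Gordon's three-block estimate.** If the coefficients repeat a block of length `p` on three
consecutive blocks, then a solution at the left end of the middle block is controlled by its
values at the ends of the outer blocks. The identity of Cayley and Hamilton for the transfer
matrix is used to the right of the site when the trace is small, and across it when the trace is
large, so that no bound on the trace is needed. -/
theorem gordon_estimate (q : ℤ → ℂ) (φ : ℤ → ℂ)
    (hφ : ∀ n, φ (n + 1) = q n * φ n - φ (n - 1)) (j : ℤ) (p : ℕ)
    (hq : ∀ k : ℤ, -p ≤ k → k < p → q (j + k + p) = q (j + k)) :
    ‖φ j‖ ≤ ‖φ (j + 2 * p)‖ + ‖φ (j + p)‖ + ‖φ (j - p)‖ ∧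
      ‖φ (j - 1)‖ ≤ ‖φ (j + 2 * p - 1)‖ + ‖φ (j + p - 1)‖ + ‖φ (j - p - 1)‖ := by
  obtain ⟨a, b, c, d, hdet, h⟩ := exists_transfer (fun k => q (j + k)) p
  obtain ⟨h1, h1'⟩ := h φ j fun k _ => by simpa using hφ (j + k)
  obtain ⟨h0, h0'⟩ := h φ (j - p) fun k hk => by
    have := hq (k - p) (by omega) (by omega)
    rw [hφ (j - p + k)]
    have e : j + ((k : ℤ) - p) + p = j + k := by ring
    have e' : j + ((k : ℤ) - p) = j - p + k := by ring
    rw [e, e'] at this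
    rw [this]
  obtain ⟨h2, h2'⟩ := h φ (j + p) fun k hk => by
    have := hq k (by omega) (by omega)
    rw [hφ (j + p + k)]
    have e : j + (k : ℤ) + p = j + p + k := by ring
    rw [e] at this
    rw [this]
  have e0 : j - (p : ℤ) + p = j := by ring
  have e2 : j + (p : ℤ) + p = j + 2 * p := by ring
  rw [e0] at h0 h0'
  rw [e2] at h2 h2'
  have key : ∀ x2 x1 x0 y t : ℂ, x2 - t * x1 + x0 = 0 → x1 - t * x0 + y = 0 →
      ‖x0‖ ≤ ‖x2‖ + ‖x1‖ + ‖y‖ := by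
    intro x2 x1 x0 y t ha hb
    rcases le_total ‖t‖ 1 with ht | ht
    · have : x0 = t * x1 - x2 := by linear_combination ha
      calc ‖x0‖ ≤ ‖t * x1‖ + ‖x2‖ := by rw [this]; exact norm_sub_le _ _
        _ ≤ 1 * ‖x1‖ + ‖x2‖ := by rw [norm_mul]; gcongr
        _ ≤ _ := by linarith [norm_nonneg y]
    · have : t * x0 = x1 + y := by linear_combination -hb
      calc ‖x0‖ ≤ ‖t‖ * ‖x0‖ := le_mul_of_one_le_left (norm_nonneg _) ht
        _ = ‖x1 + y‖ := by rw [← norm_mul, this]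
        _ ≤ ‖x1‖ + ‖y‖ := norm_add_le _ _
        _ ≤ _ := by linarith [norm_nonneg x2]
  constructor
  · refine key _ _ _ _ (a + d) ?_ ?_
    · rw [h2, h1, h1']; linear_combination (-φ j) * hdet
    · rw [h1]
      linear_combination (-φ (j - p)) * hdet - d * h0 + b * h0'
  · refine key _ _ _ _ (a + d) ?_ ?_
    · rw [h2', h1, h1']; linear_combination (-φ (j - 1)) * hdet
    · rw [h1']
      linear_combination (-φ (j - p - 1)) * hdet + c * h0 - a * h0'

/-- A solution of the eigenvalue equation that vanishes at two neighbouring sites is zero. -/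
theorem eq_zero_of_two_zeros (q : ℤ → ℂ) (φ : ℤ → ℂ)
    (hφ : ∀ n, φ (n + 1) = q n * φ n - φ (n - 1)) (j : ℤ) (h0 : φ j = 0) (h1 : φ (j - 1) = 0) :
    ∀ n, φ n = 0 := by
  have h : ∀ n : ℤ, φ n = 0 ∧ φ (n - 1) = 0 := by
    intro n
    induction n using Int.inductionOn' (b := j) with
    | zero => exact ⟨h0, h1⟩
    | succ k _ ih => exact ⟨by rw [hφ, ih.1, ih.2]; simp, by simpa using ih.1⟩
    | pred k _ ih =>
      refine ⟨ih.2, ?_⟩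
      have := hφ (k - 1)
      rw [sub_add_cancel, ih.1, ih.2] at this
      simpa using this
  exact fun n => (h n).1

theorem tendsto_coord_zero (φ : ℓ²(ℤ, ℂ)) :
    Filter.Tendsto (fun n => ‖φ n‖) Filter.cofinite (nhds 0) := by
  have h := ((memℓp_gen_iff (by norm_num)).1 (lp.memℓp φ)).tendsto_cofinite_zero
  have h2 := (Real.continuous_sqrt.tendsto 0).comp h
  simp only [Real.sqrt_zero] at h2
  refine h2.congr fun n => ?_
  simp [Real.sqrt_sq]

/-- **Gordon's criterion.** If blocks of unbounded length around a fixed site are repeated three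
times in the potential, then the Schrödinger operator has no eigenvectors. -/
theorem eq_zero_of_frequently_cube (V : ℤ → ℝ) (hV : ∃ C : ℝ, 0 ≤ C ∧ ∀ n, |V n| ≤ C) (j : ℤ)
    (p : ℕ → ℕ) (hp : StrictMono p)
    (hcube : ∃ᶠ n in Filter.atTop, ∀ k : ℤ, -p n ≤ k → k < p n → V (j + k + p n) = V (j + k))
    (E : ℂ) (φ : ℓ²(ℤ, ℂ)) (hE : schrodinger V hV φ = E • φ) : φ = 0 := by
  have hφ : ∀ n, φ (n + 1) = (E - V n) * φ n - φ (n - 1) := by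
    intro n
    have h := congrArg (fun ψ : ℓ²(ℤ, ℂ) => ψ n) hE
    simp only [schrodinger_apply, lp.coeFn_smul, Pi.smul_apply, smul_eq_mul] at h
    linear_combination h
  have lim : ∀ (a b : ℤ), b ≠ 0 →
      Filter.Tendsto (fun n => ‖φ (a + b * (p n : ℤ))‖) Filter.atTop (nhds 0) := by
    intro a b hb
    refine (tendsto_coord_zero φ).comp ?_
    rw [← Nat.cofinite_eq_atTop]
    refine Function.Injective.tendsto_cofinite fun m n hmn => hp.injective ?_
    have : b * (p m : ℤ) = b * (p n : ℤ) := add_left_cancel hmn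
    exact_mod_cast mul_left_cancel₀ hb this
  have zero : ∀ i : ℤ, (∃ᶠ n in Filter.atTop,
      ‖φ i‖ ≤ ‖φ (i + 2 * (p n : ℤ))‖ + ‖φ (i + 1 * (p n : ℤ))‖ + ‖φ (i + (-1) * (p n : ℤ))‖) →
      φ i = 0 := by
    intro i hi
    have h := ((lim i 2 (by norm_num)).add (lim i 1 (by norm_num))).add (lim i (-1) (by norm_num))
    simp only [add_zero] at h
    exact norm_le_zero_iff.1 (ge_of_tendsto_of_frequently h hi)
  have est := hcube.mono fun n hn =>
    gordon_estimate (fun n => E - V n) φ hφ j (p n) fun k h1 h2 => by simp only [hn k h1 h2]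
  have z := eq_zero_of_two_zeros _ φ hφ j
    (zero j (est.mono fun n hn => by
      simpa only [one_mul, neg_mul, ← sub_eq_add_neg] using hn.1))
    (zero (j - 1) (est.mono fun n hn => by
      have e2 : j - 1 + 2 * (p n : ℤ) = j + 2 * p n - 1 := by ring
      have e1 : j - 1 + 1 * (p n : ℤ) = j + p n - 1 := by ring
      have e0 : j - 1 + -1 * (p n : ℤ) = j - p n - 1 := by ring
      rw [e2, e1, e0]
      exact hn.2))
  exact lp.ext (funext z)

/-! ### Self-adjointness and the resolvent -/

theorem inner_translation (m : ℤ) (φ ψ : ℓ²(ℤ, ℂ)) :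
    ⟪translation m φ, ψ⟫_ℂ = ⟪φ, translation (-m) ψ⟫_ℂ := by
  rw [lp.inner_eq_tsum, lp.inner_eq_tsum]
  rw [← (Equiv.addRight m).tsum_eq fun n => ⟪φ n, translation (-m) ψ n⟫_ℂ]
  refine tsum_congr fun n => ?_
  change ⟪φ (n + m), ψ n⟫_ℂ = ⟪φ (n + m), ψ (n + m + -m)⟫_ℂ
  rw [add_neg_cancel_right]

theorem inner_potential (V : ℤ → ℝ) (hV : ∃ C : ℝ, 0 ≤ C ∧ ∀ n, |V n| ≤ C) (φ ψ : ℓ²(ℤ, ℂ)) :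
    ⟪potential V hV φ, ψ⟫_ℂ = ⟪φ, potential V hV ψ⟫_ℂ := by
  rw [lp.inner_eq_tsum, lp.inner_eq_tsum]
  refine tsum_congr fun n => ?_
  change ⟪(V n : ℂ) * φ n, ψ n⟫_ℂ = ⟪φ n, (V n : ℂ) * ψ n⟫_ℂ
  simp
  ring

theorem isSelfAdjoint_schrodinger (V : ℤ → ℝ) (hV : ∃ C : ℝ, 0 ≤ C ∧ ∀ n, |V n| ≤ C) :
    IsSelfAdjoint (schrodinger V hV) := by
  rw [ContinuousLinearMap.isSelfAdjoint_iff_isSymmetric]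
  intro φ ψ
  have h := inner_translation (-1) φ ψ
  rw [neg_neg] at h
  simp only [schrodinger, ContinuousLinearMap.coe_coe, add_apply,
    inner_add_left, inner_add_right, inner_translation 1, h, inner_potential]
  ring

section SelfAdjoint

variable {E : Type*} [NormedAddCommGroup E] [InnerProductSpace ℂ E] [CompleteSpace E]

theorem isUnit_sub_of_im_pos {H : E →L[ℂ] E} (hH : IsSelfAdjoint H) {z : ℂ} (hz : 0 < z.im) :
    IsUnit (H - z • ContinuousLinearMap.id ℂ E) := by
  have h : z ∉ spectrum ℂ H := fun h => by
    have := hH.mem_spectrum_eq_re h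
    rw [this] at hz
    simp at hz
  rw [spectrum.notMem_iff] at h
  have := h.neg
  rwa [neg_sub, Algebra.algebraMap_eq_smul_one] at this

theorem sub_apply_inverse {H : E →L[ℂ] E} (hH : IsSelfAdjoint H) {z : ℂ} (hz : 0 < z.im) (φ : E) :
    (H - z • ContinuousLinearMap.id ℂ E)
      (Ring.inverse (H - z • ContinuousLinearMap.id ℂ E) φ) = φ := by
  have h := Ring.mul_inverse_cancel _ (isUnit_sub_of_im_pos hH hz)
  exact congrArg (fun T : E →L[ℂ] E => T φ) h

theorem inverse_sub_apply {H : E →L[ℂ] E} (hH : IsSelfAdjoint H) {z : ℂ} (hz : 0 < z.im) (φ : E) :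
    Ring.inverse (H - z • ContinuousLinearMap.id ℂ E)
      ((H - z • ContinuousLinearMap.id ℂ E) φ) = φ := by
  have h := Ring.inverse_mul_cancel _ (isUnit_sub_of_im_pos hH hz)
  exact congrArg (fun T : E →L[ℂ] E => T φ) h

theorem im_inner_sub_apply {H : E →L[ℂ] E} (hH : IsSelfAdjoint H) (z : ℂ) (ψ : E) :
    (⟪ψ, (H - z • ContinuousLinearMap.id ℂ E) ψ⟫_ℂ).im = -(z.im * ‖ψ‖ ^ 2) := by
  have h : (⟪ψ, H ψ⟫_ℂ).im = 0 := by
    have h1 := (ContinuousLinearMap.isSelfAdjoint_iff_isSymmetric.1 hH) ψ ψ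
    have h2 := inner_conj_symm (𝕜 := ℂ) ψ (H ψ)
    simp only [ContinuousLinearMap.coe_coe] at h1
    rw [h1] at h2
    exact Complex.conj_eq_iff_im.1 h2
  have h3 : ⟪ψ, ψ⟫_ℂ = ((‖ψ‖ ^ 2 : ℝ) : ℂ) := by
    rw [inner_self_eq_norm_sq_to_K]; simp
  simp only [sub_apply, smul_apply,
    ContinuousLinearMap.id_apply, inner_sub_right, inner_smul_right, Complex.sub_im, h, h3,
    Complex.im_mul_ofReal]
  ring

/-- The bound `‖(H - z)⁻¹‖ ≤ 1 / Im z` for the resolvent of a self-adjoint operator. -/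
theorem im_mul_norm_inverse_le {H : E →L[ℂ] E} (hH : IsSelfAdjoint H) {z : ℂ} (hz : 0 < z.im)
    (φ : E) : z.im * ‖Ring.inverse (H - z • ContinuousLinearMap.id ℂ E) φ‖ ≤ ‖φ‖ := by
  set ψ := Ring.inverse (H - z • ContinuousLinearMap.id ℂ E) φ with hψ
  have h1 := im_inner_sub_apply hH z ψ
  rw [hψ, sub_apply_inverse hH hz, ← hψ] at h1
  have h2 : z.im * ‖ψ‖ ^ 2 ≤ ‖ψ‖ * ‖φ‖ := by
    calc z.im * ‖ψ‖ ^ 2 = |(⟪ψ, φ⟫_ℂ).im| := by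
          rw [h1, abs_neg, abs_of_nonneg (by positivity)]
      _ ≤ ‖⟪ψ, φ⟫_ℂ‖ := Complex.abs_im_le_norm _
      _ ≤ _ := norm_inner_le_norm _ _
  rcases (norm_nonneg ψ).eq_or_lt with h | h
  · rw [← h]; simp
  · nlinarith

/-- If `t` is not an eigenvalue of the self-adjoint operator `H`, the range of `H - t` is dense. -/
theorem denseRange_sub_of_injective {H : E →L[ℂ] E} (hH : IsSelfAdjoint H) (t : ℝ)
    (hinj : ∀ ψ, H ψ = (t : ℂ) • ψ → ψ = 0) :
    DenseRange (H - (t : ℂ) • ContinuousLinearMap.id ℂ E) := by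
  have hS : IsSelfAdjoint (H - (t : ℂ) • ContinuousLinearMap.id ℂ E) := by
    refine hH.sub (IsSelfAdjoint.smul ?_ ?_)
    · simp [isSelfAdjoint_iff]
    · exact IsSelfAdjoint.one _
  have hbot : (LinearMap.range (H - (t : ℂ) • ContinuousLinearMap.id ℂ E : E →L[ℂ] E).toLinearMap)ᗮ
      = ⊥ := by
    rw [eq_bot_iff]
    intro ψ hψ
    refine hinj ψ ?_
    have : (H - (t : ℂ) • ContinuousLinearMap.id ℂ E) ψ = 0 := by
      rw [← inner_self_eq_zero (𝕜 := ℂ)]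
      have h1 := (ContinuousLinearMap.isSelfAdjoint_iff_isSymmetric.1 hS) ψ
        ((H - (t : ℂ) • ContinuousLinearMap.id ℂ E) ψ)
      simp only [ContinuousLinearMap.coe_coe] at h1
      rw [h1]
      exact (Submodule.mem_orthogonal' _ ψ).1 hψ _ ⟨_, rfl⟩
    exact sub_eq_zero.1 this
  have := (Submodule.dense_iff_topologicalClosure_eq_top).2
    ((Submodule.topologicalClosure_eq_top_iff).2 hbot)
  exact this

/-- Away from the eigenvalues, `ε (H - t - i ε)⁻¹` tends to zero strongly as `ε ↓ 0`: this is
clear on the range of `H - t`, which is dense. -/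
theorem tendsto_mul_resolvent_zero {H : E →L[ℂ] E} (hH : IsSelfAdjoint H) (t : ℝ)
    (hinj : ∀ ψ, H ψ = (t : ℂ) • ψ → ψ = 0) (φ : E) :
    Filter.Tendsto (fun ε : ℝ => ε *
      ‖Ring.inverse (H - ((t : ℂ) + ε * Complex.I) • ContinuousLinearMap.id ℂ E) φ‖)
      (nhdsWithin 0 (Set.Ioi 0)) (nhds 0) := by
  rw [Metric.tendsto_nhdsWithin_nhds]
  intro δ hδ
  obtain ⟨ψ, hψ⟩ := (denseRange_sub_of_injective hH t hinj).exists_dist_lt φ (half_pos hδ)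
  refine ⟨δ / (4 * (‖ψ‖ + 1)), by positivity, fun ε hε hε' => ?_⟩
  have hε0 : 0 < ε := hε
  set z : ℂ := (t : ℂ) + ε * Complex.I with hz
  have him : z.im = ε := by simp [hz]
  have hzpos : 0 < z.im := him ▸ hε0
  set R := Ring.inverse (H - z • ContinuousLinearMap.id ℂ E) with hR
  set χ := (H - (t : ℂ) • ContinuousLinearMap.id ℂ E) ψ with hχ
  have hdec : R φ = R (φ - χ) + (ψ + ((ε : ℂ) * Complex.I) • R ψ) := by
    have h1 : χ = (H - z • ContinuousLinearMap.id ℂ E) ψ + ((ε : ℂ) * Complex.I) • ψ := by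
      change H ψ - (t : ℂ) • ψ = H ψ - ((t : ℂ) + ε * Complex.I) • ψ + ((ε : ℂ) * Complex.I) • ψ
      rw [add_smul]
      abel
    have h2 : R χ = ψ + ((ε : ℂ) * Complex.I) • R ψ := by
      rw [h1, map_add, map_smul, hR, inverse_sub_apply hH hzpos]
    rw [← h2, ← map_add, sub_add_cancel]
  have b1 := im_mul_norm_inverse_le hH hzpos (φ - χ)
  have b2 := im_mul_norm_inverse_le hH hzpos ψ
  rw [him, ← hR] at b1 b2
  have b3 : ‖R φ‖ ≤ ‖R (φ - χ)‖ + (‖ψ‖ + ε * ‖R ψ‖) := by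
    calc ‖R φ‖ = ‖R (φ - χ) + (ψ + ((ε : ℂ) * Complex.I) • R ψ)‖ := by rw [← hdec]
      _ ≤ ‖R (φ - χ)‖ + (‖ψ‖ + ‖((ε : ℂ) * Complex.I) • R ψ‖) :=
        (norm_add_le _ _).trans (by gcongr; exact norm_add_le _ _)
      _ = _ := by rw [norm_smul]; simp [abs_of_pos hε0]
  have b4 : ε * (4 * (‖ψ‖ + 1)) < δ := by
    rw [Real.dist_eq, sub_zero, abs_of_pos hε0, lt_div_iff₀ (by positivity)] at hε'
    exact hε'
  rw [dist_eq_norm] at hψ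
  rw [Real.dist_eq, sub_zero, abs_of_nonneg (by positivity)]
  nlinarith [norm_nonneg ψ, mul_le_mul_of_nonneg_left b3 hε0.le,
    mul_le_mul_of_nonneg_left b2 hε0.le]

/-! ### Pure point spectral measures and eigenvectors -/

/-- `-i ε` times the Borel transform of a finite measure at `t + i ε` tends to the mass of `t`. -/
theorem tendsto_borel_transform_atom (μ : MeasureTheory.Measure ℝ) [MeasureTheory.IsFiniteMeasure μ]
    (t : ℝ) :
    Filter.Tendsto (fun ε : ℝ => (-(ε * Complex.I)) *
      ∫ s : ℝ, ((s : ℂ) - ((t : ℂ) + ε * Complex.I))⁻¹ ∂μ)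
      (nhdsWithin 0 (Set.Ioi 0)) (nhds ((μ.real {t} : ℝ) : ℂ)) := by
  have hlim : ((μ.real {t} : ℝ) : ℂ) = ∫ s : ℝ, Set.indicator {t} (fun _ => (1 : ℂ)) s ∂μ := by
    rw [MeasureTheory.integral_indicator_const _ (measurableSet_singleton t)]
    simp
  rw [hlim]
  simp_rw [← MeasureTheory.integral_const_mul]
  refine MeasureTheory.tendsto_integral_filter_of_dominated_convergence (fun _ => 1) ?_ ?_
    (MeasureTheory.integrable_const _) ?_
  · refine Filter.Eventually.of_forall fun ε => Measurable.aestronglyMeasurable ?_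
    fun_prop
  · filter_upwards [self_mem_nhdsWithin] with ε hε
    refine Filter.Eventually.of_forall fun s => ?_
    have hε0 : 0 < ε := hε
    have h1 : ε ≤ ‖(s : ℂ) - ((t : ℂ) + ε * Complex.I)‖ := by
      have := Complex.abs_im_le_norm ((s : ℂ) - ((t : ℂ) + ε * Complex.I))
      simpa [abs_of_pos hε0] using this
    rw [norm_mul, norm_inv, ← div_eq_mul_inv]
    refine div_le_one_of_le₀ ?_ (norm_nonneg _)
    simpa [abs_of_pos hε0] using h1
  · refine Filter.Eventually.of_forall fun s => ?_
    by_cases hs : s = t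
    · subst hs
      rw [Set.indicator_of_mem (Set.mem_singleton _)]
      refine tendsto_const_nhds.congr' ?_
      filter_upwards [self_mem_nhdsWithin] with ε hε
      have hε0 : (ε : ℂ) ≠ 0 := by exact_mod_cast (ne_of_gt hε)
      have : (s : ℂ) - ((s : ℂ) + ε * Complex.I) = -(ε * Complex.I) := by ring
      rw [this, mul_inv_cancel₀]
      simpa using hε0
    · rw [Set.indicator_of_notMem (by simpa using hs)]
      have hst : (s : ℂ) - ((t : ℂ) + (0 : ℝ) * Complex.I) ≠ 0 := by
        simpa [sub_eq_zero] using hs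
      have hc : ContinuousAt (fun ε : ℝ => (-(ε * Complex.I)) *
          ((s : ℂ) - ((t : ℂ) + ε * Complex.I))⁻¹) 0 := by
        refine ContinuousAt.mul (by fun_prop) (ContinuousAt.inv₀ (by fun_prop) hst)
      have := hc.tendsto
      simp only [Complex.ofReal_zero, zero_mul, neg_zero] at this
      exact this.mono_left nhdsWithin_le_nhds

/-- A self-adjoint operator without real eigenvalues has no nonzero vectors whose spectral measure
is pure point. -/
theorem purePointSubspace_subset {H : E →L[ℂ] E} (hH : IsSelfAdjoint H)
    (hinj : ∀ (t : ℝ) (ψ : E), H ψ = (t : ℂ) • ψ → ψ = 0) : purePointSubspace H ⊆ {0} := by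
  rintro φ ⟨μ, ⟨hfin, hμ⟩, S, hS, hSμ⟩
  -- An atom at `t` is detected by `-i ε (H - t - i ε)⁻¹`, which tends to zero strongly.
  have hatom : ∀ t : ℝ, μ {t} = 0 := by
    intro t
    have h1 := tendsto_borel_transform_atom μ t
    have h2 := (tendsto_mul_resolvent_zero hH t (hinj t) φ).const_mul ‖φ‖
    rw [mul_zero] at h2
    have h3 : Filter.Tendsto (fun ε : ℝ => (-(ε * Complex.I)) *
        ∫ s : ℝ, ((s : ℂ) - ((t : ℂ) + ε * Complex.I))⁻¹ ∂μ)
        (nhdsWithin 0 (Set.Ioi 0)) (nhds 0) := by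
      refine squeeze_zero_norm' ?_ h2
      filter_upwards [self_mem_nhdsWithin] with ε hε
      have hε0 : 0 < ε := hε
      rw [← hμ _ (by simpa using hε0), norm_mul]
      have e : ‖-((ε : ℂ) * Complex.I)‖ = ε := by simp [abs_of_pos hε0]
      rw [e, mul_left_comm]
      exact mul_le_mul_of_nonneg_left (norm_inner_le_norm _ _) hε0.le
    have h4 := tendsto_nhds_unique h1 h3
    have h5 : μ.real {t} = 0 := by exact_mod_cast h4
    exact (MeasureTheory.measureReal_eq_zero_iff).1 h5
  have hzero : μ = 0 := by
    rw [← MeasureTheory.Measure.measure_univ_eq_zero, ← Set.union_compl_self S]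
    refine MeasureTheory.measure_union_null ?_ hSμ
    rw [← Set.biUnion_of_singleton S, MeasureTheory.measure_biUnion_null_iff hS]
    exact fun t _ => hatom t
  -- With `μ = 0`, the vector `ψ = (H - i)⁻¹ φ` satisfies `⟨ψ, (H - i) ψ⟩ = 0`.
  have hz : 0 < Complex.I.im := by simp
  have h1 := hμ Complex.I hz
  rw [hzero, MeasureTheory.integral_zero_measure] at h1
  set ψ := Ring.inverse (H - Complex.I • ContinuousLinearMap.id ℂ E) φ with hψ
  have hφ : (H - Complex.I • ContinuousLinearMap.id ℂ E) ψ = φ := sub_apply_inverse hH hz φ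
  have h2 := im_inner_sub_apply hH Complex.I ψ
  rw [hφ, ← inner_conj_symm, h1] at h2
  have h3 : ψ = 0 := by simpa using h2
  rw [Set.mem_singleton_iff, ← hφ, h3, map_zero]

end SelfAdjoint

theorem spectrumOn_eq_empty {E : Type*} [NormedAddCommGroup E] [InnerProductSpace ℂ E]
    {H : E →L[ℂ] E} {M : Set E} (hM : M ⊆ {0}) :
    spectrumOn H M = ∅ := by
  refine Set.eq_empty_of_forall_notMem fun z hz => hz ?_
  rcases Set.subset_singleton_iff_eq.1 hM with rfl | rfl
  · exact Set.bijOn_empty _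
  · simp

/-! ### Almost every point meets the repetitions infinitely often -/

section Recurrence

open MeasureTheory Filter

variable {Ω : Type*} [MeasurableSpace Ω] {ν : Measure Ω} {T : Ω → Ω}

/-- If almost every orbit visits `B` at least `M` times within each stretch of `N` steps, then `B`
fills at least the proportion `M / N` of every set `D` that is mapped into itself. -/
theorem mul_measure_le_of_visits (hT : MeasurePreserving T ν ν) {B D : Set Ω}
    (hB : MeasurableSet B) (hD : MeasurableSet D) (hDT : ∀ x ∈ D, T x ∈ D) (M N : ℕ)
    (hvisit : ∀ᵐ x ∂ν, ∃ i : ℕ, i + M ≤ N ∧ ∀ k < M, T^[i + k] x ∈ B) :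
    M * ν D ≤ N * ν (B ∩ D) := by
  have hBD := hB.inter hD
  have hiter : ∀ (i : ℕ), ∀ x ∈ D, T^[i] x ∈ D := by
    intro i x hx
    induction i with
    | zero => exact hx
    | succ i ih => rw [Function.iterate_succ_apply']; exact hDT _ ih
  calc (M : ENNReal) * ν D = ∫⁻ x, D.indicator (fun _ => (M : ENNReal)) x ∂ν := by
        rw [lintegral_indicator_const hD]
    _ ≤ ∫⁻ x, ∑ i ∈ Finset.range N, (T^[i] ⁻¹' (B ∩ D)).indicator 1 x ∂ν := by
        refine lintegral_mono_ae ?_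
        filter_upwards [hvisit] with x ⟨i, hi, hk⟩
        by_cases hx : x ∈ D
        · rw [Set.indicator_of_mem hx]
          have hsub : (Finset.range M).image (fun k => i + k) ⊆ Finset.range N := by
            intro j hj
            obtain ⟨k, hk, rfl⟩ := Finset.mem_image.1 hj
            have := Finset.mem_range.1 hk
            exact Finset.mem_range.2 (by omega)
          refine le_trans ?_ (Finset.sum_le_sum_of_subset hsub)
          rw [Finset.sum_image fun a _ b _ h => Nat.add_left_cancel h]
          have : ∀ k ∈ Finset.range M,
              (T^[i + k] ⁻¹' (B ∩ D)).indicator (1 : Ω → ENNReal) x = 1 := fun k hkM => by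
            have hmem : x ∈ T^[i + k] ⁻¹' (B ∩ D) :=
              ⟨hk k (Finset.mem_range.1 hkM), hiter _ _ hx⟩
            rw [Set.indicator_of_mem hmem, Pi.one_apply]
          rw [Finset.sum_congr rfl this]
          simp
        · rw [Set.indicator_of_notMem hx]
          exact zero_le
    _ = ∑ i ∈ Finset.range N, ν (B ∩ D) := by
        rw [lintegral_finsetSum _ fun i _ =>
          measurable_one.indicator ((hT.iterate i).measurable hBD)]
        refine Finset.sum_congr rfl fun i _ => ?_
        rw [lintegral_indicator_one ((hT.iterate i).measurable hBD),
          (hT.iterate i).measure_preimage hBD.nullMeasurableSet]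
    _ = N * ν (B ∩ D) := by simp

/-- If, for every `n`, almost every orbit visits `B n` with frequency at least `1 / C`, then almost
every orbit visits infinitely many of the sets `B n` at one and the same time. No ergodicity is
needed, as the frequency bound is inherited by the set of exceptional points. -/
theorem ae_exists_frequently_mem [IsFiniteMeasure ν] (hT : MeasurePreserving T ν ν)
    {B : ℕ → Set Ω} (hB : ∀ n, MeasurableSet (B n)) (C : ℕ) (M : ℕ → ℕ) (hM : ∀ n, 0 < M n)
    (hvisit : ∀ n, ∀ᵐ x ∂ν, ∃ i : ℕ, i + M n ≤ C * M n ∧ ∀ k < M n, T^[i + k] x ∈ B n) :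
    ∀ᵐ x ∂ν, ∃ j : ℕ, ∃ᶠ n in atTop, T^[j] x ∈ B n := by
  set G : Set Ω := limsup B atTop with hG
  have hGm : MeasurableSet G := MeasurableSet.measurableSet_limsup hB
  have hmem : ∀ x, x ∈ G ↔ ∃ᶠ n in atTop, x ∈ B n := fun x => mem_limsup_iff_frequently_mem
  set D : Set Ω := ⋂ j : ℕ, T^[j] ⁻¹' Gᶜ with hD
  have hDm : MeasurableSet D := MeasurableSet.iInter fun j =>
    (hT.iterate j).measurable hGm.compl
  have hDT : ∀ x ∈ D, T x ∈ D := fun x hx => Set.mem_iInter.2 fun j => by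
    have := Set.mem_iInter.1 hx (j + 1)
    rwa [Set.mem_preimage, Function.iterate_succ_apply] at this
  have hbound : ∀ n, ν D ≤ C * ν (B n ∩ D) := by
    intro n
    have h := mul_measure_le_of_visits hT (hB n) hDm hDT (M n) (C * M n) (hvisit n)
    have h0 : (M n : ENNReal) ≠ 0 := by exact_mod_cast (hM n).ne'
    rw [Nat.cast_mul, mul_comm (C : ENNReal), mul_assoc] at h
    exact (ENNReal.mul_le_mul_iff_right h0 (ENNReal.natCast_ne_top _)).1 h
  -- The tails of the sequence `B n ∩ D` decrease to the empty set.
  have hanti : Antitone fun n => ⋃ k ≥ n, B k ∩ D := fun m n hmn =>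
    Set.biUnion_subset_biUnion_left fun k hk => le_trans hmn hk
  have hempty : ⋂ n, ⋃ k ≥ n, B k ∩ D = ∅ := by
    refine Set.eq_empty_of_forall_notMem fun x hx => ?_
    have hx' : ∀ n, ∃ k ≥ n, x ∈ B k ∩ D := fun n => by
      obtain ⟨k, hk, hkx⟩ := Set.mem_iUnion₂.1 (Set.mem_iInter.1 hx n)
      exact ⟨k, hk, hkx⟩
    have hxD : x ∈ D := (hx' 0).choose_spec.2.2
    have hxG : x ∈ G := (hmem x).2 (frequently_atTop.2 fun n => by
      obtain ⟨k, hk, hkB⟩ := hx' n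
      exact ⟨k, hk, hkB.1⟩)
    exact Set.mem_iInter.1 hxD 0 hxG
  have htend := tendsto_measure_iInter_atTop (μ := ν)
    (fun n => (MeasurableSet.iUnion fun k => MeasurableSet.iUnion fun _ =>
      (hB k).inter hDm).nullMeasurableSet) hanti ⟨0, measure_ne_top _ _⟩
  rw [hempty, measure_empty] at htend
  have hlim := ENNReal.Tendsto.const_mul (a := (C : ENNReal)) htend
    (Or.inr (ENNReal.natCast_ne_top C))
  rw [mul_zero] at hlim
  have hzero : ν D = 0 := le_antisymm (ge_of_tendsto' hlim fun n =>
    (hbound n).trans (mul_le_mul_right (measure_mono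
      (Set.subset_biUnion_of_mem (u := fun k => B k ∩ D) (le_refl n))) _)) zero_le
  refine measure_mono_null (fun x hx => Set.mem_iInter.2 fun j hj => hx ⟨j, ?_⟩) hzero
  exact (hmem _).1 hj

end Recurrence

theorem measurableSet_cubeSet {k : ℕ} (p : ℕ) : MeasurableSet (cubeSet (Fin k) p) := by
  have e : cubeSet (Fin k) p = ⋂ k : ℤ, ⋂ _ : -p ≤ k, ⋂ _ : k < p, {x | x (k + p) = x k} := by
    ext x; simp [cubeSet]
  rw [e]
  exact MeasurableSet.iInter fun k => MeasurableSet.iInter fun _ => MeasurableSet.iInter fun _ =>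
    measurableSet_eq_fun (measurable_pi_apply _) (measurable_pi_apply _)

/-- If three-block repetitions of infinitely many periods are centred at one place of `x`, then
the operator of `x` has empty pure point spectrum. -/
theorem purePointSpectrum_eq_empty_of_cubes {k : ℕ} (f : Fin k → ℝ) (x : ℤ → Fin k) (p : ℕ → ℕ)
    (hp : StrictMono p) (j : ℕ)
    (h : ∃ᶠ n in Filter.atTop, shift^[j] x ∈ cubeSet (Fin k) (p n)) :
    purePointSpectrum (operatorAt f x) = ∅ := by
  refine spectrumOn_eq_empty (purePointSubspace_subset (isSelfAdjoint_schrodinger _ _)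
    fun t ψ hψ => eq_zero_of_frequently_cube _ _ (j : ℤ) p hp
      (h.mono fun n hn i h1 h2 => ?_) _ ψ hψ)
  have := hn i h1 h2
  rw [shift_iterate, shift_iterate] at this
  rw [show (j : ℤ) + i + p n = i + p n + j by ring, show (j : ℤ) + i = i + j by ring, this]

end ArnouxRauzy

theorem mainTheorem7 (X : Set (ℤ → Fin 3)) (hX : ArnouxRauzy.IsTribonacciSubshift X)
    (f : Fin 3 → ℝ) (hf : ∃ a b : Fin 3, f a ≠ f b)
    (ν : MeasureTheory.Measure (ℤ → Fin 3)) [MeasureTheory.IsProbabilityMeasure ν]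
    (hνX : ∀ᵐ x ∂ν, x ∈ X)
    (hν : MeasureTheory.MeasurePreserving (ArnouxRauzy.shift (A := Fin 3)) ν ν) :
    ∀ᵐ x ∂ν, ArnouxRauzy.purePointSpectrum (ArnouxRauzy.operatorAt f x) = ∅ := by
  obtain ⟨L, hL, hLX⟩ := ArnouxRauzy.exists_isARLanguage hX
  have hmono : StrictMono fun n => ArnouxRauzy.tribPeriod (n + 4) := fun m n hmn =>
    ArnouxRauzy.tribPeriod_strictMono (Nat.add_lt_add_right hmn 4)
  filter_upwards [ArnouxRauzy.ae_exists_frequently_mem hν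
    (fun n => ArnouxRauzy.measurableSet_cubeSet (ArnouxRauzy.tribPeriod (n + 4))) 5648
    ArnouxRauzy.tribPeriod ArnouxRauzy.tribPeriod_pos
    fun n => hνX.mono fun x hx => ArnouxRauzy.exists_many_cubes hL (hLX x hx) n] with x ⟨j, hj⟩
  exact ArnouxRauzy.purePointSpectrum_eq_empty_of_cubes f x _ hmono j hj
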